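/- Let $\Omega\subseteq\mathbb R^3$ be open, let $\rho,\kappa$ be measurable functions with $\varepsilon\le\rho,\kappa\le C$ on $\Omega$ for some constants $\varepsilon>0$ and $C$, let $\Gamma=\operatorname{diag}(\rho,\rho,\rho,\kappa)$, and let $T>0$. For an interval $[a,b]$ let $U_{[a,b]}$ be the Hilbert space of the fields $u=(v,p)\in L^2(\Omega\times[a,b];\mathbb R^3\times\mathbb R)$ with the energy inner product $$\langle u_1,u_2\rangle_U=\int_a^b\!\!\int_\Omega\langle\Gamma u_1,u_2\rangle\,dx\,dt .$$ For $q=(q_v,q_p)\in U_{[a,b]}$ write $u=F_{[a,b]}q$ if $u=(v,p)\in U_{[a,b]}$ is a solution of the linearized acoustic system $$\rho\,\partial_t v+\operatorname{grad}p=q_v,\qquad \kappa\,\partial_t p+\operatorname{div}v=q_p\qquad\text{in }\Omega\times[a,b],$$ with $u=0$ at $t=a$ and $u=0$ on $\partial\Omega\times[a,b]$, all in the weak sense: for all $\eta\in C_c^\infty(\mathbb R^3\times(-\infty,b);\mathbb R^3)$ and $\chi\in C_c^\infty(\mathbb R^3\times(-\infty,b))$, $$-\int_a^b\!\!\int_\Omega\big(\rho\,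 v\cdot\partial_t\eta+p\operatorname{div}\eta\big)=\int_a^b\!\!\int_\Omega q_v\cdot\eta,\qquad -\int_a^b\!\!\int_\Omega\big(\kappa\, p\,\partial_t\chi+v\cdot\operatorname{grad}\chi\big)=\int_a^b\!\!\int_\Omega q_p\,\chi .$$ Write $F$ for both $F_{[0,T]}$ and $F_{[T,2T]}$, and let $$(\mathcal S_a u)(x,t)=\begin{pmatrix}-v(x,2T-t)\\ p(x,2T-t)\end{pmatrix}$$ be the acoustic time-reversal operator, which maps $U_{[0,T]}$ to $U_{[T,2T]}$ and $U_{[T,2T]}$ to $U_{[0,T]}$. Then: 1. On both time intervals a source $q$ has at most one solution $Fq$. 2. For all $q,(\phi,\psi)\in U_{[0,T]}$ for which $Fq$ and $F\mathcal S_a\Gamma(\phi,\psi)$ exist, $$\Big\langle Fq,\binom{\phi}{\psi}\Big\rangle_U=\Big\langle q,\ \Gamma^{-1}\mathcal S_aF\mathcal S_a\Gamma\binom{\phi}{\psi}\Big\rangle_U .$$ 3. If $Fq$ exists for every $q\in U_{[0,T]}$, then $F$ is an everywhere defined bounded linear operator on $U_{[0,T]}$ and on $U_{[T,2T]}$, and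 for every $(\phi,\psi)\in U_{[0,T]}$ $$\Gamma^{-1}\mathcal S_aF\mathcal S_a\Gamma\binom{\phi}{\psi}=F^*\binom{\phi}{\psi},$$ where $F^*$ is the adjoint of $F$ in the Hilbert space $U_{[0,T]}$. 4. If $\Omega=\mathbb R^3$, then $Fq$ exists for every $q\in U_{[0,T]}$. -/

import Mathlib

open MeasureTheory Set
open scoped ENNReal ContDiff InnerProductSpace

noncomputable section

namespace Acoustic

/-- Physical space `ℝ³` with its Euclidean norm. -/
abbrev Space : Type := EuclideanSpace ℝ (Fin 3)

/-- An acoustic medium: an open set `Ω ⊆ ℝ³` with a density `ρ` and a compressibility `κ` which,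
on `Ω`, are bounded above and bounded below by a positive constant, so that
`Γ = diag (ρ, ρ, ρ, κ)` is bounded and uniformly positive definite on `Ω`. -/
structure Medium where
  /-- the spatial region -/
  Ω : Set Space
  isOpen_Ω : IsOpen Ω
  /-- the density -/
  ρ : Space → ℝ
  /-- the compressibility -/
  κ : Space → ℝ
  measurable_ρ : Measurable ρ
  measurable_κ : Measurable κ
  uniform_pos : ∃ ε : ℝ, 0 < ε ∧ ∀ x ∈ Ω, ε ≤ ρ x ∧ ε ≤ κ x
  bounded : ∃ C : ℝ, ∀ x ∈ Ω, ρ x ≤ C ∧ κ x ≤ C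

namespace Medium

variable (m : Medium)

/-- Lebesgue measure `dx dt` on the space-time cylinder `Ω × [a, b]`. -/
def cyl (a b : ℝ) : Measure (Space × ℝ) :=
  (volume : Measure (Space × ℝ)).restrict (m.Ω ×ˢ Icc a b)

/-- The measure `c(x) dx dt` on the space-time cylinder `Ω × [a, b]`. -/
def wcyl (c : Space → ℝ) (a b : ℝ) : Measure (Space × ℝ) :=
  (m.cyl a b).withDensity fun z => ENNReal.ofReal (c z.1)

/-- The space `U` over the time interval `[a, b]`: pairs `u = (v, p)` of a velocity field
`v : Ω × [a, b] → ℝ³` and a pressure field `p : Ω × [a, b] → ℝ`, with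
`⟪u₁, u₂⟫ = ∫∫ (ρ ⟪v₁, v₂⟫ + κ p₁ p₂) dx dt = ∫∫ ⟪Γ u₁, u₂⟫ dx dt`, the energy inner product.
It is the Hilbert sum of `L²(ρ dx dt; ℝ³)` and `L²(κ dx dt; ℝ)`; as `ρ` and `κ` are bounded above
and below, its elements are the square integrable fields on `Ω × [a, b]`. -/
abbrev U (a b : ℝ) : Type :=
  WithLp 2 (Lp Space 2 (m.wcyl m.ρ a b) × Lp ℝ 2 (m.wcyl m.κ a b))

variable {m} {a b : ℝ}

/-- The velocity component of a field, as a function of `(x, t)`. -/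
def vel (u : m.U a b) : Space × ℝ → Space := u.fst

/-- The pressure component of a field, as a function of `(x, t)`. -/
def pres (u : m.U a b) : Space × ℝ → ℝ := u.snd

theorem ae_mem_wcyl (c : Space → ℝ) : ∀ᵐ z ∂(m.wcyl c a b), z.1 ∈ m.Ω := by
  have h : ∀ᵐ z ∂(m.cyl a b), z ∈ m.Ω ×ˢ Icc a b :=
    ae_restrict_mem (m.isOpen_Ω.measurableSet.prod measurableSet_Icc)
  filter_upwards [(withDensity_absolutelyContinuous (m.cyl a b)
    (fun z => ENNReal.ofReal (c z.1))).ae_le h] with z hz using hz.1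

/-- Multiplication by a measurable function of `x` that is bounded on `Ω` preserves `L²`. -/
theorem memLp_mul {E : Type} [NormedAddCommGroup E] [NormedSpace ℝ E] {c w : Space → ℝ}
    (hw : Measurable w) {C : ℝ} (hC : ∀ x ∈ m.Ω, |w x| ≤ C) (f : Lp E 2 (m.wcyl c a b)) :
    MemLp (fun z => w z.1 • f z) 2 (m.wcyl c a b) := by
  have h : MemLp (fun z : Space × ℝ => w z.1) ∞ (m.wcyl c a b) :=
    memLp_top_of_bound (hw.comp measurable_fst).aestronglyMeasurable C (by
      filter_upwards [ae_mem_wcyl c] with z hz using hC _ hz)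
  exact (Lp.memLp f).smul h

theorem exists_bound :
    ∃ C : ℝ, ∀ x ∈ m.Ω, |m.ρ x| ≤ C ∧ |m.κ x| ≤ C ∧ |(m.ρ x)⁻¹| ≤ C ∧ |(m.κ x)⁻¹| ≤ C := by
  obtain ⟨ε, hε, h⟩ := m.uniform_pos
  obtain ⟨C, hC⟩ := m.bounded
  refine ⟨max C ε⁻¹, fun x hx => ?_⟩
  obtain ⟨h1, h2⟩ := h x hx
  obtain ⟨h3, h4⟩ := hC x hx
  have p1 : 0 < m.ρ x := hε.trans_le h1
  have p2 : 0 < m.κ x := hε.trans_le h2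
  rw [abs_of_pos p1, abs_of_pos p2, abs_of_pos (inv_pos.2 p1), abs_of_pos (inv_pos.2 p2)]
  exact ⟨le_max_of_le_left h3, le_max_of_le_left h4,
    le_max_of_le_right (inv_anti₀ hε h1), le_max_of_le_right (inv_anti₀ hε h2)⟩

/-- `Γ (v, p) = (ρ v, κ p)`. -/
def gamma (u : m.U a b) : m.U a b :=
  WithLp.toLp 2
    ((memLp_mul m.measurable_ρ (fun x hx => (exists_bound.choose_spec x hx).1) u.fst).toLp,
     (memLp_mul m.measurable_κ (fun x hx => (exists_bound.choose_spec x hx).2.1) u.snd).toLp)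

/-- `Γ⁻¹ (v, p) = (ρ⁻¹ v, κ⁻¹ p)`. -/
def gammaInv (u : m.U a b) : m.U a b :=
  WithLp.toLp 2
    ((memLp_mul m.measurable_ρ.inv
        (fun x hx => (exists_bound.choose_spec x hx).2.2.1) u.fst).toLp,
     (memLp_mul m.measurable_κ.inv
        (fun x hx => (exists_bound.choose_spec x hx).2.2.2) u.snd).toLp)

/-- The reflection `(x, t) ↦ (x, r - t)` of space-time. -/
def reflect (r : ℝ) (z : Space × ℝ) : Space × ℝ := (z.1, r - z.2)

theorem measurePreserving_reflect {c : Space → ℝ} (hc : Measurable c) {r a' b' : ℝ}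
    (ha : a' = r - b) (hb : b' = r - a) :
    MeasurePreserving (reflect r) (m.wcyl c a' b') (m.wcyl c a b) := by
  have h0 : MeasurePreserving (reflect r) (volume : Measure (Space × ℝ)) volume :=
    (MeasurePreserving.id _).prod (Measure.measurePreserving_sub_left volume r)
  have hs : reflect r ⁻¹' (m.Ω ×ˢ Icc a b) = m.Ω ×ˢ Icc a' b' := by
    ext z
    simp only [reflect, mem_preimage, mem_prod, mem_Icc, ha, hb]
    constructor <;> rintro ⟨h1, h2, h3⟩ <;> exact ⟨h1, by linarith, by linarith⟩
  have h1 : MeasurePreserving (reflect r) (m.cyl a' b') (m.cyl a b) := by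
    have := h0.restrict_preimage (s := m.Ω ×ˢ Icc a b)
      (m.isOpen_Ω.measurableSet.prod measurableSet_Icc)
    rwa [hs] at this
  refine ⟨h0.measurable, ?_⟩
  have hg : Measurable fun z : Space × ℝ => ENNReal.ofReal (c z.1) :=
    (hc.comp measurable_fst).ennreal_ofReal
  ext s hs
  rw [Measure.map_apply h0.measurable hs, wcyl, wcyl, withDensity_apply _ hs,
    withDensity_apply _ (h0.measurable hs)]
  exact h1.setLIntegral_comp_preimage hs hg

/-- The time reversal `(v, p) ↦ (-v(x, r - t), p(x, r - t))` from fields on the time interval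
`[a, b]` to fields on the reflected time interval `[a', b'] = [r - b, r - a]`. -/
def reverse (r : ℝ) {a' b' : ℝ} (ha : a' = r - b) (hb : b' = r - a) (u : m.U a b) : m.U a' b' :=
  WithLp.toLp 2
    (-Lp.compMeasurePreserving (reflect r) (measurePreserving_reflect m.measurable_ρ ha hb) u.fst,
     Lp.compMeasurePreserving (reflect r) (measurePreserving_reflect m.measurable_κ ha hb) u.snd)

/-- The acoustic time-reversal operator `S_a`, `t ↦ 2T - t`, from fields on `[0, T]` to fields on
`[T, 2T]`. -/
def revFwd (T : ℝ) (u : m.U 0 T) : m.U T (2 * T) :=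
  reverse (2 * T) (by ring) (by ring) u

/-- The acoustic time-reversal operator `S_a`, `t ↦ 2T - t`, from fields on `[T, 2T]` to fields on
`[0, T]`. -/
def revBwd (T : ℝ) (u : m.U T (2 * T)) : m.U 0 T :=
  reverse (2 * T) (by ring) (by ring) u

/-- Test functions on space-time for evolution up to time `b`: smooth, compactly supported, with
support in `{t < b}`. No vanishing is required at the initial time or on `∂Ω`. -/
structure IsTest {E : Type} [NormedAddCommGroup E] [NormedSpace ℝ E] (b : ℝ)
    (φ : Space × ℝ → E) : Prop where
  smooth : ContDiff ℝ ∞ φ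
  compact : HasCompactSupport φ
  before : tsupport φ ⊆ {z | z.2 < b}

/-- The time derivative. -/
def dt {E : Type} [NormedAddCommGroup E] [NormedSpace ℝ E] (φ : Space × ℝ → E)
    (z : Space × ℝ) : E :=
  deriv (fun s => φ (z.1, s)) z.2

/-- The spatial gradient. -/
def grad (χ : Space × ℝ → ℝ) (z : Space × ℝ) : Space :=
  gradient (fun x => χ (x, z.2)) z.1

/-- The spatial divergence. -/
def div (η : Space × ℝ → Space) (z : Space × ℝ) : ℝ :=
  ∑ i : Fin 3, (fderiv ℝ (fun x => η (x, z.2)) z.1 (EuclideanSpace.single i 1)) i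

/-- `u = (v, p)` is the (weak) solution of the acoustic system with source `q = (q_v, q_p)`,
`ρ ∂v/∂t + grad p = q_v`, `κ ∂p/∂t + div v = q_p` in `Ω × [a, b]`, `u = 0` at `t = a`, `u = 0` on
`∂Ω × [a, b]`. The initial and boundary conditions are encoded in the fact that the test functions
need not vanish at `t = a` or on `∂Ω`: integrating by parts produces no terms from there, that is,
`u` extended by zero solves the system across `t = a` and across `∂Ω`. -/
structure IsSolution (q u : m.U a b) : Prop where
  velocity : ∀ η : Space × ℝ → Space, IsTest b η →
    -(∫ z in m.Ω ×ˢ Icc a b, m.ρ z.1 * ⟪vel u z, dt η z⟫_ℝ)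
      - (∫ z in m.Ω ×ˢ Icc a b, pres u z * div η z)
      = ∫ z in m.Ω ×ˢ Icc a b, ⟪vel q z, η z⟫_ℝ
  pressure : ∀ χ : Space × ℝ → ℝ, IsTest b χ →
    -(∫ z in m.Ω ×ˢ Icc a b, m.κ z.1 * (pres u z * dt χ z))
      - (∫ z in m.Ω ×ˢ Icc a b, ⟪vel u z, grad χ z⟫_ℝ)
      = ∫ z in m.Ω ×ˢ Icc a b, pres q z * χ z

end Medium

end Acoustic

end

open Acoustic
open Acoustic.Medium (IsSolution revFwd revBwd gamma gammaInv)

namespace Acoustic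

/-! Everything rests on one duality identity. Write the acoustic system for the scalar components of
fields extended by zero, so that it becomes a symmetric first order system on all of space-time with
coefficients independent of time. If `u` solves it with source `q`, tested on `{t < b}`, and `w`
solves it with source `g`, tested on `{t > a}`, then `∑ ∫ u g = -∑ ∫ q w`
(`IsWeakSolution.duality`). Formally one tests the equation for `u` with `w`, but neither field is
smooth enough.

The way around is to pass to correlations `h ↦ ∫ f(z) g(z - h) dz`, which are continuous for square
integrable `f` and `g`. Testing the equation for `u` with translates of a smooth `k` supported in
`{t < 0}`, weighting by `w`, and doing the same with the roles exchanged, the spatial terms cancel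
by symmetry. What remains is `∂ₜ A = B` on `{t < 0}`, where `A` compares `c u` against `w` with `u`
against `c w`, and `B 0` is the defect of the identity. Shifts in time alone do not move `c`, so `A`
vanishes on the time axis; slicing and continuity give `B 0 = 0`
(`eq_zero_of_weak_time_derivative`).

Existence in whole space comes from an energy estimate with weight `t - a`, bounding a test field by
the differential operator applied to it, followed by Hahn–Banach and Riesz
(`exists_isWeakSolution`).

Uniqueness: solve the reversed whole-space problem with the difference of two solutions as source;
duality makes the square norm of the difference vanish. The dual solution need not live in `Ω`, so
every open `Ω` is covered. Reciprocity: time reversal turns a forward solution with source `S Γ v`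
into a backward one with source `-Γ v`, to which duality applies. Boundedness: an everywhere defined
map with a formal adjoint is linear with closed graph. Existence on the later interval follows by
translation, a product of two time reversals. -/

instance : (volume : Measure (Space × ℝ)).IsAddHaarMeasure :=
  inferInstanceAs (Measure.prod volume volume).IsAddHaarMeasure

/-! ### Correlations of square integrable functions. -/

section Correlation

variable {G : Type*} [NormedAddCommGroup G] [MeasurableSpace G] [BorelSpace G]
  [SecondCountableTopology G] {μ : Measure G} [μ.IsAddHaarMeasure]

/-- The correlation `h ↦ ∫ f(z) g(z - h) dz` of two functions. -/
noncomputable def corr (μ : Measure G) (f g : G → ℝ) (h : G) : ℝ := ∫ z, f z * g (z - h) ∂μ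

/-- The correlation is the `L²` inner product of `f` with a translate of `g`, and translation acts
continuously on `L²`. -/
theorem continuous_corr [LocallyCompactSpace G] {f g : G → ℝ} (hf : MemLp f 2 μ)
    (hg : MemLp g 2 μ) : Continuous (corr μ f g) := by
  have hmp : ∀ h : G, MeasurePreserving (fun z : G => z - h) μ μ :=
    fun h => measurePreserving_sub_right μ h
  let τ : G → C(G, G) := fun h => ⟨fun z => z - h, by fun_prop⟩
  have hτ : Continuous τ := ContinuousMap.continuous_of_continuous_uncurry _ (by
    simp only [τ, Function.uncurry_def, ContinuousMap.coe_mk]; fun_prop)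
  have hc : Continuous fun h => Lp.compMeasurePreserving (τ h) (hmp h) (hg.toLp g) :=
    Continuous.compMeasurePreservingLp continuous_const hτ hmp (by norm_num)
  have : corr μ f g = fun h => ⟪Lp.compMeasurePreserving (τ h) (hmp h) (hg.toLp g),
      hf.toLp f⟫_ℝ := by
    ext h
    rw [L2.inner_def]
    refine integral_congr_ae ?_
    filter_upwards [hf.coeFn_toLp, Lp.coeFn_compMeasurePreserving (hg.toLp g) (hmp h),
      (hmp h).quasiMeasurePreserving.ae_eq_comp hg.coeFn_toLp] with z h1 h2 h3
    have h2' : (Lp.compMeasurePreserving (τ h) (hmp h) (hg.toLp g)) z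
      = (hg.toLp g) (z - h) := h2
    have h3' : (hg.toLp g) (z - h) = g (z - h) := h3
    rw [h2', h3', h1]
    simp
  rw [this]
  exact hc.inner continuous_const

/-- The bound `|f g k| ≤ (f² + g²) |k|` reduces this to a product and a convolution of integrable
functions. -/
theorem integrable_corr_integrand [SigmaFinite μ]
    {f g k : G → ℝ} (hf : MemLp f 2 μ) (hg : MemLp g 2 μ)
    (hk : Integrable k μ) :
    Integrable (fun p : G × G => f p.1 * g (p.1 - p.2) * k p.2) (μ.prod μ) := by
  have h1 : Integrable (fun p : G × G => f p.1 ^ 2 * |k p.2|) (μ.prod μ) :=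
    hf.integrable_sq.mul_prod hk.abs
  have h2 : Integrable (fun p : G × G => |k p.2| * g (p.1 - p.2) ^ 2) (μ.prod μ) :=
    Integrable.convolution_integrand (ContinuousLinearMap.mul ℝ ℝ) hk.abs hg.integrable_sq
  have hm : AEStronglyMeasurable (fun p : G × G => f p.1 * (k p.2 * g (p.1 - p.2)))
      (μ.prod μ) := hf.1.comp_fst.mul
    (AEStronglyMeasurable.convolution_integrand (ContinuousLinearMap.mul ℝ ℝ) hk.1 hg.1)
  refine (h1.add h2).mono' (hm.congr (.of_forall fun p => by ring)) (.of_forall fun p => ?_)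
  simp only [Pi.add_apply, norm_mul, Real.norm_eq_abs]
  have : |f p.1| * |g (p.1 - p.2)| ≤ f p.1 ^ 2 + g (p.1 - p.2) ^ 2 := by
    rw [← sq_abs (f p.1), ← sq_abs (g (p.1 - p.2))]
    nlinarith [sq_nonneg (|f p.1| - |g (p.1 - p.2)|), sq_nonneg (|f p.1|),
      sq_nonneg (|g (p.1 - p.2)|)]
  nlinarith [abs_nonneg (k p.2)]

/-- Substitute `y = z - h` and apply Fubini. This converts an equation tested with translates of `k`
into one for correlations. -/
theorem integral_mul_integral_sub [SigmaFinite μ] [μ.IsNegInvariant]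
    {f g k : G → ℝ} (hf : MemLp f 2 μ) (hg : MemLp g 2 μ)
    (hk : Integrable k μ) :
    ∫ z, f z * ∫ y, g y * k (z - y) ∂μ ∂μ = ∫ h, corr μ f g h * k h ∂μ := by
  calc ∫ z, f z * ∫ y, g y * k (z - y) ∂μ ∂μ
      = ∫ z, ∫ h, f z * g (z - h) * k h ∂μ ∂μ := by
        refine integral_congr_ae (.of_forall fun z => ?_)
        simp only
        rw [← integral_sub_left_eq_self (fun y => g y * k (z - y)) μ z, ← integral_const_mul]
        simp [mul_assoc]
    _ = ∫ h, ∫ z, f z * g (z - h) * k h ∂μ ∂μ :=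
        integral_integral_swap (integrable_corr_integrand hf hg hk)
    _ = _ := by simp only [corr, integral_mul_const]

theorem integral_mul_integral_add [SigmaFinite μ] [μ.IsNegInvariant]
    {f g k : G → ℝ} (hf : MemLp f 2 μ) (hg : MemLp g 2 μ)
    (hk : Integrable k μ) :
    ∫ y, g y * ∫ z, f z * k (z - y) ∂μ ∂μ = ∫ h, corr μ f g h * k h ∂μ := by
  have := integral_mul_integral_sub hg hf hk.comp_neg
  simp only [neg_sub] at this
  rw [this, ← integral_neg_eq_self]
  refine integral_congr_ae (.of_forall fun h => ?_)
  simp only [corr, neg_neg, sub_neg_eq_add]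
  congr 1
  rw [← integral_sub_right_eq_self _ h]
  simp [mul_comm]

end Correlation

/-! ### Derivatives on space-time and restriction to the time axis. -/

theorem fderiv_const_sub_comp {k : Space × ℝ → ℝ} (hk : Differentiable ℝ k) (z y : Space × ℝ) :
    fderiv ℝ (fun y => k (z - y)) y = -fderiv ℝ k (z - y) := by
  have h := (hk (z - y)).hasFDerivAt.comp y ((hasFDerivAt_id y).const_sub z)
  rw [show fderiv ℝ (fun y => k (z - y)) y = _ from h.fderiv]
  exact ContinuousLinearMap.ext fun v => by simp

theorem fderiv_comp_prodMk_left {F : Type*} [NormedAddCommGroup F] [NormedSpace ℝ F]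
    {f : Space × ℝ → F} (hf : Differentiable ℝ f) (x : Space) (t : ℝ) (v : Space) :
    fderiv ℝ (fun x => f (x, t)) x v = fderiv ℝ f (x, t) (v, 0) := by
  have h := HasFDerivAt.comp (f := fun x => (x, t)) (g := f) x (hf (x, t)).hasFDerivAt
    ((hasFDerivAt_id x).prodMk (hasFDerivAt_const t x))
  rw [show fderiv ℝ (fun x => f (x, t)) x = _ from h.fderiv]
  simp

theorem hasDerivAt_comp_prodMk_right {F : Type*} [NormedAddCommGroup F] [NormedSpace ℝ F]
    {f : Space × ℝ → F} (hf : Differentiable ℝ f) (x : Space) (t : ℝ) :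
    HasDerivAt (fun t => f (x, t)) (fderiv ℝ f (x, t) (0, 1)) t :=
  (hf (x, t)).hasFDerivAt.comp_hasDerivAt t ((hasDerivAt_const t x).prodMk (hasDerivAt_id t))

theorem fderiv_mul_prod_apply_time {ψ : Space → ℝ} {φ : ℝ → ℝ} (hψ : Differentiable ℝ ψ)
    (hφ : Differentiable ℝ φ) (z : Space × ℝ) :
    fderiv ℝ (fun z : Space × ℝ => ψ z.1 * φ z.2) z (0, 1) = ψ z.1 * deriv φ z.2 := by
  have h1 : HasFDerivAt (fun z : Space × ℝ => ψ z.1)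
      ((fderiv ℝ ψ z.1).comp (ContinuousLinearMap.fst ℝ Space ℝ)) z :=
    (hψ z.1).hasFDerivAt.comp z hasFDerivAt_fst
  have h2 : HasFDerivAt (fun z : Space × ℝ => φ z.2)
      ((fderiv ℝ φ z.2).comp (ContinuousLinearMap.snd ℝ Space ℝ)) z :=
    (hφ z.2).hasFDerivAt.comp z hasFDerivAt_snd
  rw [show fderiv ℝ (fun z : Space × ℝ => ψ z.1 * φ z.2) z = _ from (h1.mul h2).fderiv]
  simp

theorem hasCompactSupport_mul_prod {ψ : Space → ℝ} {φ : ℝ → ℝ} (hψ : HasCompactSupport ψ)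
    (hφ : HasCompactSupport φ) : HasCompactSupport fun z : Space × ℝ => ψ z.1 * φ z.2 := by
  refine HasCompactSupport.intro (hψ.isCompact.prod hφ.isCompact) fun z hz => ?_
  rw [mem_prod, not_and_or] at hz
  rcases hz with h | h
  · simp [image_eq_zero_of_notMem_tsupport h]
  · simp [image_eq_zero_of_notMem_tsupport h]

theorem tsupport_mul_prod_subset {ψ : Space → ℝ} {φ : ℝ → ℝ} :
    (tsupport fun z : Space × ℝ => ψ z.1 * φ z.2) ⊆ {z | z.2 ∈ tsupport φ} := by
  refine closure_minimal (fun z hz => ?_) ((isClosed_tsupport φ).preimage continuous_snd)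
  exact subset_tsupport φ (right_ne_zero_of_mul hz)

/-- If `∂ₜ A = B` holds for continuous functions in the sense of distributions in `{t < 0}` and
`A` vanishes on the time axis, then `B` vanishes at the origin. -/
theorem eq_zero_of_weak_time_derivative {A B : Space × ℝ → ℝ} (hA : Continuous A)
    (hB : Continuous B) (hA0 : ∀ s, A (0, s) = 0)
    (h : ∀ k : Space × ℝ → ℝ, ContDiff ℝ ∞ k → HasCompactSupport k →
      tsupport k ⊆ {z | z.2 ∈ Iio 0} →
      (∫ z, A z * fderiv ℝ k z (0, 1)) + ∫ z, B z * k z = 0) : B 0 = 0 := by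
  have key : ∀ φ : ℝ → ℝ, ContDiff ℝ ∞ φ → HasCompactSupport φ → tsupport φ ⊆ Iio 0 →
      ∫ s, φ s • B (0, s) = 0 := by
    intro φ hφ hφc hφs
    have hφd : Differentiable ℝ φ := hφ.differentiable (by simp)
    have hφ' : Continuous (deriv φ) := hφ.continuous_deriv (by simp)
    let j : Space × ℝ → ℝ := fun z => A z * deriv φ z.2 + B z * φ z.2
    have hj : Continuous j := by
      have := hφ.continuous
      simp only [j]; fun_prop
    have hj0 : ∀ y s, s ∉ tsupport φ → j (y, s) = 0 := by
      intro y s hs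
      have h1 : deriv φ s = 0 := by
        by_contra hne
        exact hs (support_deriv_subset hne)
      simp [j, h1, image_eq_zero_of_notMem_tsupport hs]
    -- Only time is integrated out. `J` is continuous and annihilates every test function of space,
    -- hence vanishes at every point, in particular at `0`, where the `A` term drops out.
    let J : Space → ℝ := fun y => ∫ s, j (y, s)
    have hJ : Continuous J := by
      rw [← continuousOn_univ]
      exact continuousOn_integral_of_compact_support (f := fun y s => j (y, s)) hφc.isCompact
        (by exact hj.continuousOn) (fun y s _ hs => hj0 y s hs)
    have hJ0 : ∀ᵐ y, J y = 0 := by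
      refine ae_eq_zero_of_integral_contDiff_smul_eq_zero hJ.locallyIntegrable ?_
      intro ψ hψ hψc
      have hψd : Differentiable ℝ ψ := hψ.differentiable (by simp)
      have hk := h (fun z => ψ z.1 * φ z.2)
        ((hψ.comp contDiff_fst).mul (hφ.comp contDiff_snd))
        (hasCompactSupport_mul_prod hψc hφc) fun z hz => hφs (tsupport_mul_prod_subset hz)
      simp only [fderiv_mul_prod_apply_time hψd hφd] at hk
      have c1 : Continuous fun z : Space × ℝ => A z * (ψ z.1 * deriv φ z.2) := by
        have := hψ.continuous
        fun_prop
      have c2 : Continuous fun z : Space × ℝ => B z * (ψ z.1 * φ z.2) := by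
        have := hψ.continuous
        have := hφ.continuous
        fun_prop
      have i1 : Integrable fun z : Space × ℝ => A z * (ψ z.1 * deriv φ z.2) :=
        c1.integrable_of_hasCompactSupport
          ((hasCompactSupport_mul_prod hψc hφc.deriv).mul_left (f := A))
      have i2 : Integrable fun z : Space × ℝ => B z * (ψ z.1 * φ z.2) :=
        c2.integrable_of_hasCompactSupport
          ((hasCompactSupport_mul_prod hψc hφc).mul_left (f := B))
      rw [← integral_add i1 i2] at hk
      have i3 : Integrable fun z : Space × ℝ => A z * (ψ z.1 * deriv φ z.2) +
          B z * (ψ z.1 * φ z.2) := i1.add i2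
      rw [show (volume : Measure (Space × ℝ)) = (volume : Measure Space).prod volume from rfl,
        integral_prod _ i3] at hk
      rw [← hk]
      refine integral_congr_ae (.of_forall fun y => ?_)
      simp only [J, j, smul_eq_mul]
      rw [← integral_const_mul]
      refine integral_congr_ae (.of_forall fun s => ?_)
      simp only
      ring
    have hJz : J = fun _ => 0 := (hJ.ae_eq_iff_eq volume continuous_const).1 hJ0
    have h0 := congrFun hJz 0
    simp only [J, j, hA0, zero_mul, zero_add] at h0
    simpa [mul_comm] using h0
  have hB' : Continuous fun s : ℝ => B (0, s) := by fun_prop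
  have hae : ∀ᵐ s : ℝ, s ∈ Iio (0 : ℝ) → B (0, s) = 0 :=
    isOpen_Iio.ae_eq_zero_of_integral_contDiff_smul_eq_zero
      (hB'.locallyIntegrable.locallyIntegrableOn _) key
  have heq : EqOn (fun s : ℝ => B (0, s)) (fun _ => 0) (Iio 0) :=
    Measure.eqOn_open_of_ae_eq (μ := volume)
      ((ae_restrict_iff' measurableSet_Iio).2 hae) isOpen_Iio hB'.continuousOn
      continuousOn_const
  -- The origin is only a boundary point of the open half-axis where `B` is known to vanish.
  have := heq.closure hB' continuous_const (by rw [closure_Iio]; exact mem_Iic.2 le_rfl)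
  exact this

/-! ### Weak solutions of symmetric systems and their duality. -/

section System

variable {ι : Type*} [Fintype ι]

/-- `u` is a weak solution of the first order system
`c j ∂ₜ (u j) + ∑ l, ∂_{d j l} (u l) = q j`, tested against functions supported in `{t ∈ S}`. -/
def IsWeakSolution (S : Set ℝ) (c : ι → Space → ℝ) (d : ι → ι → Space)
    (u q : ι → Space × ℝ → ℝ) : Prop :=
  ∀ k : Space × ℝ → ℝ, ContDiff ℝ ∞ k → HasCompactSupport k → tsupport k ⊆ {z | z.2 ∈ S} → ∀ j,
    (∫ z, c j z.1 * u j z * fderiv ℝ k z (0, 1)) + ∑ l, ∫ z, u l z * fderiv ℝ k z (d j l, 0)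
      = -∫ z, q j z * k z

theorem integrable_mul_integral_sub {f g k : Space × ℝ → ℝ} (hf : MemLp f 2) (hg : MemLp g 2)
    (hk : Integrable k) : Integrable fun z => f z * ∫ y, g y * k (z - y) := by
  refine (integrable_corr_integrand hf hg hk).integral_prod_left.congr (.of_forall fun z => ?_)
  simp only
  rw [← integral_sub_left_eq_self (fun y => g y * k (z - y)) volume z, ← integral_const_mul]
  simp [mul_assoc]

theorem integrable_mul_integral_add {f g k : Space × ℝ → ℝ} (hf : MemLp f 2) (hg : MemLp g 2)
    (hk : Integrable k) : Integrable fun y => g y * ∫ z, f z * k (z - y) := by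
  simpa using integrable_mul_integral_sub hg hf hk.comp_neg

/-- Solutions of a symmetric first order system with time-independent coefficients on
`{t < b}` are dual to those on `{t > a}`. -/
theorem IsWeakSolution.duality {a b : ℝ} {c : ι → Space → ℝ} {d : ι → ι → Space}
    (hd : ∀ j l, d j l = d l j) {u q w g : ι → Space × ℝ → ℝ}
    (hu : IsWeakSolution (Iio b) c d u q) (hw : IsWeakSolution (Ioi a) c d w g)
    (hu0 : ∀ j z, z.2 < a → u j z = 0) (hw0 : ∀ j z, b < z.2 → w j z = 0)
    (mu : ∀ j, MemLp (u j) 2) (mq : ∀ j, MemLp (q j) 2) (mw : ∀ j, MemLp (w j) 2)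
    (mg : ∀ j, MemLp (g j) 2) (mcu : ∀ j, MemLp (fun z => c j z.1 * u j z) 2)
    (mcw : ∀ j, MemLp (fun z => c j z.1 * w j z) 2) :
    ∑ j, ∫ z, u j z * g j z = -∑ j, ∫ z, q j z * w j z := by
  let A : Space × ℝ → ℝ := fun h => ∑ j, (corr volume (fun z => c j z.1 * u j z) (w j) h -
    corr volume (u j) (fun z => c j z.1 * w j z) h)
  let B : Space × ℝ → ℝ := fun h => ∑ j, (corr volume (q j) (w j) h + corr volume (u j) (g j) h)
  suffices hB : B 0 = 0 by
    simp only [B, corr, sub_zero, Finset.sum_add_distrib] at hB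
    linarith
  refine eq_zero_of_weak_time_derivative (A := A) ?_ ?_ ?_ ?_
  · exact continuous_finsetSum _ fun j _ =>
      (continuous_corr (mcu j) (mw j)).sub (continuous_corr (mu j) (mcw j))
  · exact continuous_finsetSum _ fun j _ =>
      (continuous_corr (mq j) (mw j)).add (continuous_corr (mu j) (mg j))
  -- A purely temporal shift leaves `z.1` unchanged, so the coefficient is the same in both
  -- correlations.
  · intro s
    refine Finset.sum_eq_zero fun j _ => sub_eq_zero.2 ?_
    refine integral_congr_ae (.of_forall fun z => ?_)
    simp only [Prod.fst_sub, sub_zero]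
    ring
  · intro k hk hkc hks
    have hkd : Differentiable ℝ k := hk.differentiable (by simp)
    have hDc : ∀ v, Continuous fun z => fderiv ℝ k z v := fun v =>
      (hk.continuous_fderiv (by simp)).clm_apply continuous_const
    have hDi : ∀ v, Integrable fun z => fderiv ℝ k z v := fun v =>
      (hDc v).integrable_of_hasCompactSupport (hkc.fderiv_apply (𝕜 := ℝ) v)
    have hki : Integrable k := hk.continuous.integrable_of_hasCompactSupport hkc
    -- The equation for `u` tested with `z ↦ k (z - y)`, multiplied by `w j y` and integrated over
    -- `y`.
    have e1 : ∀ j, (∫ h, corr volume (fun z => c j z.1 * u j z) (w j) h * fderiv ℝ k h (0, 1))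
        + ∑ l, ∫ h, corr volume (u l) (w j) h * fderiv ℝ k h (d j l, 0)
        = -∫ h, corr volume (q j) (w j) h * k h := by
      intro j
      rw [← integral_mul_integral_add (mcu j) (mw j) (hDi _),
        ← integral_mul_integral_add (mq j) (mw j) hki]
      simp only [fun l => (integral_mul_integral_add (mu l) (mw j) (hDi (d j l, 0))).symm]
      rw [← integral_finsetSum _ fun l _ => integrable_mul_integral_add (mu l) (mw j) (hDi _),
        ← integral_add (integrable_mul_integral_add (mcu j) (mw j) (hDi _))
          (integrable_finsetSum _ fun l _ => integrable_mul_integral_add (mu l) (mw j) (hDi _)),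
        ← integral_neg]
      refine integral_congr_ae (.of_forall fun y => ?_)
      simp only
      -- Past `b` the factor `w` is zero; for `y.2 ≤ b` the translate of `k` lives strictly before
      -- `y.2`, hence in `{t < b}`.
      rcases lt_or_ge b y.2 with hy | hy
      · simp [hw0 j y hy]
      rw [← Finset.mul_sum, ← mul_add, ← mul_neg]
      congr 1
      have := hu (fun z => k (z - y)) (hk.comp (contDiff_id.sub contDiff_const))
        (hkc.comp_homeomorph (Homeomorph.subRight y)) (fun z hz => ?_) j
      · simpa only [fderiv_comp_sub] using this
      · have h1 : z - y ∈ tsupport k :=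
          tsupport_comp_subset_preimage k (f := fun z => z - y) (by fun_prop) hz
        have h2 := hks h1
        simp only [mem_ofPred_eq, mem_Iio, Prod.snd_sub] at h2 ⊢
        linarith
    -- The equation for `w` tested with `y ↦ k (z - y)`; differentiating in `y` produces the minus
    -- signs on the left.
    have e2 : ∀ j, -(∫ h, corr volume (u j) (fun z => c j z.1 * w j z) h * fderiv ℝ k h (0, 1))
        - ∑ l, ∫ h, corr volume (u j) (w l) h * fderiv ℝ k h (d j l, 0)
        = -∫ h, corr volume (u j) (g j) h * k h := by
      intro j
      rw [← integral_mul_integral_sub (mu j) (mcw j) (hDi _),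
        ← integral_mul_integral_sub (mu j) (mg j) hki]
      simp only [fun l => (integral_mul_integral_sub (mu j) (mw l) (hDi (d j l, 0))).symm]
      rw [← integral_finsetSum _ fun l _ => integrable_mul_integral_sub (mu j) (mw l) (hDi _),
        ← integral_neg, ← integral_neg]
      refine (integral_sub (integrable_mul_integral_sub (mu j) (mcw j) (hDi _)).neg
        (integrable_finsetSum _ fun l _ =>
          integrable_mul_integral_sub (mu j) (mw l) (hDi _))).symm.trans ?_
      refine integral_congr_ae (.of_forall fun z => ?_)
      simp only [Pi.neg_apply]
      rcases lt_or_ge z.2 a with hz | hz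
      · simp [hu0 j z hz]
      rw [← Finset.mul_sum, ← mul_neg, ← mul_sub, ← mul_neg]
      congr 1
      have := hw (fun y => k (z - y)) (hk.comp (contDiff_const.sub contDiff_id))
        (hkc.comp_homeomorph (Homeomorph.subLeft z)) (fun y hy => ?_) j
      · simp only [fderiv_const_sub_comp hkd, neg_apply, mul_neg, integral_neg,
          Finset.sum_neg_distrib] at this
        linarith
      · have h1 : z - y ∈ tsupport k :=
          tsupport_comp_subset_preimage k (f := fun y => z - y) (by fun_prop) hy
        have h2 := hks h1
        simp only [mem_ofPred_eq, mem_Iio, mem_Ioi, Prod.snd_sub] at h2 ⊢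
        linarith
    have hci : ∀ {f h : Space × ℝ → ℝ}, MemLp f 2 → MemLp h 2 → ∀ {κ : Space × ℝ → ℝ},
        Continuous κ → HasCompactSupport κ → Integrable fun z => corr volume f h z * κ z :=
      fun hf hh _ hκ hκc => ((continuous_corr hf hh).mul hκ).integrable_of_hasCompactSupport
        hκc.mul_left
    have hDs : ∀ v, HasCompactSupport fun z => fderiv ℝ k z v := fun v =>
      hkc.fderiv_apply (𝕜 := ℝ) v
    have eA : ∫ z, A z * fderiv ℝ k z (0, 1) = ∑ j,
        ((∫ h, corr volume (fun z => c j z.1 * u j z) (w j) h * fderiv ℝ k h (0, 1)) -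
        ∫ h, corr volume (u j) (fun z => c j z.1 * w j z) h * fderiv ℝ k h (0, 1)) := by
      simp only [A, Finset.sum_mul, sub_mul]
      refine (integral_finsetSum _ fun j _ => (hci (mcu j) (mw j) (hDc _) (hDs _)).sub
        (hci (mu j) (mcw j) (hDc _) (hDs _))).trans ?_
      exact Finset.sum_congr rfl fun j _ => integral_sub (hci (mcu j) (mw j) (hDc _) (hDs _))
        (hci (mu j) (mcw j) (hDc _) (hDs _))
    have eB : ∫ z, B z * k z = ∑ j, ((∫ h, corr volume (q j) (w j) h * k h) +
        ∫ h, corr volume (u j) (g j) h * k h) := by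
      simp only [B, Finset.sum_mul, add_mul]
      refine (integral_finsetSum _ fun j _ => (hci (mq j) (mw j) hk.continuous hkc).add
        (hci (mu j) (mg j) hk.continuous hkc)).trans ?_
      exact Finset.sum_congr rfl fun j _ => integral_add (hci (mq j) (mw j) hk.continuous hkc)
        (hci (mu j) (mg j) hk.continuous hkc)
    -- The spatial terms of the two equations coincide by symmetry of `d`, so they cancel in the
    -- sum.
    have hsymm : ∑ j, ∑ l, ∫ h, corr volume (u l) (w j) h * fderiv ℝ k h (d j l, 0) =
        ∑ j, ∑ l, ∫ h, corr volume (u j) (w l) h * fderiv ℝ k h (d j l, 0) := by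
      rw [Finset.sum_comm]
      exact Finset.sum_congr rfl fun j _ => Finset.sum_congr rfl fun l _ => by rw [hd]
    have s1 := Finset.sum_congr (rfl : (Finset.univ : Finset ι) = Finset.univ) fun j _ => e1 j
    have s2 := Finset.sum_congr (rfl : (Finset.univ : Finset ι) = Finset.univ) fun j _ => e2 j
    simp only [Finset.sum_add_distrib, Finset.sum_sub_distrib, Finset.sum_neg_distrib] at s1 s2
    rw [eA, eB, Finset.sum_add_distrib, Finset.sum_sub_distrib]
    linarith

end System

/-! ### Existence in whole space by an energy estimate. -/

/-- If `‖B φ‖ ≤ C ‖A φ‖` for all `φ`, then `A* u = B* q` has a solution `u` for every `q`. -/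
theorem exists_inner_eq_of_norm_le {H V : Type*} [NormedAddCommGroup H] [InnerProductSpace ℝ H]
    [CompleteSpace H] [AddCommGroup V] [Module ℝ V] (A B : V →ₗ[ℝ] H) (C : ℝ)
    (h : ∀ φ, ‖B φ‖ ≤ C * ‖A φ‖) (q : H) : ∃ u : H, ∀ φ, ⟪u, A φ⟫_ℝ = ⟪q, B φ⟫_ℝ := by
  let ℓ : V →ₗ[ℝ] ℝ := (innerSL ℝ q).toLinearMap.comp B
  have hℓ : ∀ φ, ℓ φ = ⟪q, B φ⟫_ℝ := fun φ => rfl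
  have hker : LinearMap.ker A ≤ LinearMap.ker ℓ := by
    intro φ hφ
    rw [LinearMap.mem_ker] at hφ ⊢
    have := h φ
    rw [hφ, norm_zero, mul_zero] at this
    rw [hℓ, norm_le_zero_iff.1 this, inner_zero_right]
  -- The functional `A φ ↦ ⟪q, B φ⟫` is well defined and bounded on the range of `A`; Hahn–Banach
  -- extends it and Riesz represents the extension by `u`.
  let g : LinearMap.range A →ₗ[ℝ] ℝ :=
    ((LinearMap.ker A).liftQ ℓ hker).comp A.quotKerEquivRange.symm.toLinearMap
  have hg : ∀ φ, g ⟨A φ, LinearMap.mem_range_self A φ⟩ = ℓ φ := fun φ => by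
    simp only [g, LinearMap.comp_apply, LinearEquiv.coe_coe,
      LinearMap.quotKerEquivRange_symm_apply_image, Submodule.mkQ_apply, Submodule.liftQ_apply]
  have hb : ∀ x, ‖g x‖ ≤ ‖q‖ * C * ‖x‖ := by
    rintro ⟨_, φ, rfl⟩
    rw [hg, hℓ]
    calc ‖⟪q, B φ⟫_ℝ‖ ≤ ‖q‖ * ‖B φ‖ := norm_inner_le_norm _ _
      _ ≤ ‖q‖ * (C * ‖A φ‖) := by gcongr; exact h φ
      _ = _ := by rw [mul_assoc]; rfl
  obtain ⟨G, hG, -⟩ := exists_extension_norm_eq _ (g.mkContinuous _ hb)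
  refine ⟨(InnerProductSpace.toDual ℝ H).symm G, fun φ => ?_⟩
  rw [InnerProductSpace.toDual_symm_apply, ← hℓ, ← hg]
  exact hG ⟨A φ, LinearMap.mem_range_self A φ⟩

theorem integrable_coeff_mul {c : Space → ℝ} (hc : Measurable c) {C : ℝ} (hC : ∀ x, |c x| ≤ C)
    {f : Space × ℝ → ℝ} (hf : Continuous f) (hfc : HasCompactSupport f)
    (μ : Measure (Space × ℝ)) [IsFiniteMeasureOnCompacts μ] :
    Integrable (fun z => c z.1 * f z) μ :=
  (hf.integrable_of_hasCompactSupport hfc).bdd_mul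
    (hc.comp measurable_fst).aestronglyMeasurable (.of_forall fun z => hC z.1)

/-- Lebesgue measure on the time slab `ℝ³ × [a, b]`. -/
noncomputable def slab (a b : ℝ) : Measure (Space × ℝ) := volume.restrict (univ ×ˢ Icc a b)

instance (a b : ℝ) : IsFiniteMeasureOnCompacts (slab a b) := by
  unfold slab; infer_instance

theorem slab_eq_prod (a b : ℝ) :
    slab a b = (volume : Measure Space).prod (volume.restrict (Icc a b)) := by
  rw [slab, show (volume : Measure (Space × ℝ)) = (volume : Measure Space).prod volume from rfl,
    ← Measure.prod_restrict, Measure.restrict_univ]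

/-- Integrate `∂ₜ ((t - a) ψ)` in time: the weight kills the boundary term at `a`, the hypothesis on
`ψ` the one at `b`. -/
theorem integral_slab_time_derivative {a b : ℝ} (hab : a ≤ b) {c : Space → ℝ} (hc : Measurable c)
    {C : ℝ} (hC : ∀ x, |c x| ≤ C) {ψ : Space × ℝ → ℝ} (hψ : ContDiff ℝ ∞ ψ)
    (hψc : HasCompactSupport ψ) (hψb : ∀ x, ψ (x, b) = 0) :
    ∫ z, c z.1 * ((z.2 - a) * fderiv ℝ ψ z (0, 1)) ∂slab a b = -∫ z, c z.1 * ψ z ∂slab a b := by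
  have hψd : Differentiable ℝ ψ := hψ.differentiable (by simp)
  have hD : Continuous fun z => fderiv ℝ ψ z (0, 1) :=
    (hψ.continuous_fderiv (by simp)).clm_apply continuous_const
  have hψct := hψ.continuous
  have c1 : Continuous fun z : Space × ℝ => (z.2 - a) * fderiv ℝ ψ z (0, 1) := by fun_prop
  have i1 := integrable_coeff_mul hc hC c1 ((hψc.fderiv_apply (𝕜 := ℝ) (0, 1)).mul_left)
    (slab a b)
  have i2 := integrable_coeff_mul hc hC hψct hψc (slab a b)
  rw [eq_neg_iff_add_eq_zero, ← integral_add i1 i2]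
  have i3 : Integrable (fun z : Space × ℝ => c z.1 * ((z.2 - a) * fderiv ℝ ψ z (0, 1)) +
    c z.1 * ψ z) (slab a b) := i1.add i2
  rw [slab_eq_prod] at i3 ⊢
  rw [integral_prod _ i3]
  refine integral_eq_zero_of_ae (.of_forall fun x => ?_)
  simp only [Pi.zero_apply, ← mul_add]
  rw [integral_const_mul, integral_Icc_eq_integral_Ioc, ← intervalIntegral.integral_of_le hab,
    intervalIntegral.integral_eq_sub_of_hasDerivAt (f := fun t => (t - a) * ψ (x, t))]
  · simp [hψb]
  · intro t _
    have h2 := hasDerivAt_comp_prodMk_right hψd x t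
    convert! ((hasDerivAt_id t).sub_const a).mul h2 using 1
    simp only [id_eq]
    ring
  · refine Continuous.intervalIntegrable ?_ _ _
    fun_prop

theorem integral_slab_space_derivative {a b : ℝ} {ψ : Space × ℝ → ℝ} (hψ : ContDiff ℝ ∞ ψ)
    (hψc : HasCompactSupport ψ) (v : Space) :
    ∫ z, (z.2 - a) * fderiv ℝ ψ z (v, 0) ∂slab a b = 0 := by
  have hψd : Differentiable ℝ ψ := hψ.differentiable (by simp)
  have hD : Continuous fun z => fderiv ℝ ψ z (v, 0) :=
    (hψ.continuous_fderiv (by simp)).clm_apply continuous_const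
  have c1 : Continuous fun z : Space × ℝ => (z.2 - a) * fderiv ℝ ψ z (v, 0) := by fun_prop
  have i1 : Integrable (fun z : Space × ℝ => (z.2 - a) * fderiv ℝ ψ z (v, 0)) (slab a b) :=
    c1.integrable_of_hasCompactSupport ((hψc.fderiv_apply (𝕜 := ℝ) (v, 0)).mul_left)
  rw [slab_eq_prod] at i1 ⊢
  rw [integral_prod_symm _ i1]
  refine integral_eq_zero_of_ae (.of_forall fun t => ?_)
  simp only [Pi.zero_apply]
  rw [integral_const_mul]
  have hs : ContDiff ℝ ∞ fun x => ψ (x, t) := hψ.comp (contDiff_id.prodMk contDiff_const)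
  have hsc : HasCompactSupport fun x => ψ (x, t) := by
    refine HasCompactSupport.intro (hψc.isCompact.image continuous_fst) fun x hx => ?_
    by_contra hne
    exact hx ⟨(x, t), subset_tsupport ψ hne, rfl⟩
  have hsd : Differentiable ℝ fun x => ψ (x, t) := hs.differentiable (by simp)
  simp only [← fderiv_comp_prodMk_left hψd]
  have hDs : Continuous fun x => fderiv ℝ (fun x => ψ (x, t)) x v :=
    (hs.continuous_fderiv (by simp)).clm_apply continuous_const
  have hint := hDs.integrable_of_hasCompactSupport (μ := volume)
    (hsc.fderiv_apply (𝕜 := ℝ) v)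
  -- Integration by parts against the constant `1`.
  have := integral_mul_fderiv_eq_neg_fderiv_mul_of_integrable (μ := (volume : Measure Space))
    (f := fun _ => (1 : ℝ)) (g := fun x => ψ (x, t)) (v := v) (by simp) (by simpa using hint)
    (by simpa using hs.continuous.integrable_of_hasCompactSupport hsc)
    (fun x _ => differentiableAt_const _) (fun x _ => hsd x)
  simp only [one_mul, fderiv_fun_const, Pi.zero_apply, zero_apply, zero_mul, integral_zero,
    neg_zero] at this
  rw [this, mul_zero]

section System

variable {ι : Type*} [Fintype ι]

/-- The energy identity for a symmetric first order system in a time slab. -/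
theorem energy_identity {a b : ℝ} (hab : a ≤ b) {c : ι → Space → ℝ} (hc : ∀ j, Measurable (c j))
    {C : ℝ} (hC : ∀ j x, |c j x| ≤ C) {d : ι → ι → Space} (hd : ∀ j l, d j l = d l j)
    {φ : ι → Space × ℝ → ℝ} (hφ : ∀ j, ContDiff ℝ ∞ (φ j)) (hφc : ∀ j, HasCompactSupport (φ j))
    (hφb : ∀ j x, φ j (x, b) = 0) :
    ∑ j, ∫ z, c j z.1 * φ j z ^ 2 ∂slab a b = -2 * ∫ z, ∑ j, (z.2 - a) *
      (c j z.1 * fderiv ℝ (φ j) z (0, 1) + ∑ l, fderiv ℝ (φ l) z (d j l, 0)) * φ j z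
        ∂slab a b := by
  have hφd : ∀ j, Differentiable ℝ (φ j) := fun j => (hφ j).differentiable (by simp)
  have hφct : ∀ j, Continuous (φ j) := fun j => (hφ j).continuous
  have hD : ∀ j v, Continuous fun z => fderiv ℝ (φ j) z v := fun j v =>
    ((hφ j).continuous_fderiv (by simp)).clm_apply continuous_const
  have hmul : ∀ j l z v, fderiv ℝ (fun z => φ j z * φ l z) z v =
      φ j z * fderiv ℝ (φ l) z v + φ l z * fderiv ℝ (φ j) z v := by
    intro j l z v
    rw [show fderiv ℝ (fun z => φ j z * φ l z) z = _ from
      ((hφd j z).hasFDerivAt.mul (hφd l z).hasFDerivAt).fderiv]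
    simp
  have ht : ∀ j, ∫ z, c j z.1 * φ j z ^ 2 ∂slab a b =
      -2 * ∫ z, c j z.1 * ((z.2 - a) * (φ j z * fderiv ℝ (φ j) z (0, 1))) ∂slab a b := by
    intro j
    have h := integral_slab_time_derivative hab (hc j) (hC j) ((hφ j).mul (hφ j))
      ((hφc j).mul_right (f' := φ j)) (fun x => by simp [hφb])
    simp only [hmul] at h
    simp only [pow_two]
    rw [← neg_eq_iff_eq_neg] at h
    rw [← h, neg_mul, ← integral_const_mul]
    congr 1
    refine integral_congr_ae (.of_forall fun z => ?_)
    simp only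
    ring
  have ix : ∀ j l, Integrable (fun z : Space × ℝ => (z.2 - a) * (φ j z *
      fderiv ℝ (φ l) z (d j l, 0))) (slab a b) := by
    intro j l
    have : Continuous fun z : Space × ℝ => (z.2 - a) * (φ j z * fderiv ℝ (φ l) z (d j l, 0)) := by
      have := hφct j
      have := hD l (d j l, 0)
      fun_prop
    exact this.integrable_of_hasCompactSupport ((hφc j).mul_right.mul_left)
  -- The spatial derivative of `φ j * φ l` integrates to zero, so these terms are antisymmetric in
  -- `j` and `l` and their double sum vanishes.
  have hx : ∀ j l, ∫ z, (z.2 - a) * (φ j z * fderiv ℝ (φ l) z (d j l, 0)) ∂slab a b =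
      -∫ z, (z.2 - a) * (φ l z * fderiv ℝ (φ j) z (d l j, 0)) ∂slab a b := by
    intro j l
    have h := integral_slab_space_derivative (a := a) (b := b) ((hφ j).mul (hφ l))
      ((hφc j).mul_right (f' := φ l)) (d j l)
    simp only [hmul, mul_add] at h
    rw [hd l j, eq_neg_iff_add_eq_zero]
    exact (integral_add (ix j l) (by simpa only [hd l j] using ix l j)).symm.trans h
  have hx0 : ∑ j, ∑ l, ∫ z, (z.2 - a) * (φ j z * fderiv ℝ (φ l) z (d j l, 0)) ∂slab a b = 0 := by
    have h1 : ∑ j, ∑ l, ∫ z, (z.2 - a) * (φ j z * fderiv ℝ (φ l) z (d j l, 0)) ∂slab a b =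
        -∑ j, ∑ l, ∫ z, (z.2 - a) * (φ j z * fderiv ℝ (φ l) z (d j l, 0)) ∂slab a b := by
      conv_lhs => rw [Finset.sum_comm]
      rw [← Finset.sum_neg_distrib]
      refine Finset.sum_congr rfl fun j _ => ?_
      rw [← Finset.sum_neg_distrib]
      exact Finset.sum_congr rfl fun l _ => hx l j
    linarith
  have it : ∀ j, Integrable (fun z : Space × ℝ => c j z.1 * ((z.2 - a) * (φ j z *
      fderiv ℝ (φ j) z (0, 1)))) (slab a b) := by
    intro j
    refine integrable_coeff_mul (hc j) (hC j) ?_ ((hφc j).mul_right.mul_left) _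
    have := hφct j
    have := hD j (0, 1)
    fun_prop
  have hsum : ∫ z, ∑ j, (z.2 - a) * (c j z.1 * fderiv ℝ (φ j) z (0, 1) +
      ∑ l, fderiv ℝ (φ l) z (d j l, 0)) * φ j z ∂slab a b =
      ∑ j, ∫ z, c j z.1 * ((z.2 - a) * (φ j z * fderiv ℝ (φ j) z (0, 1))) ∂slab a b +
      ∑ j, ∑ l, ∫ z, (z.2 - a) * (φ j z * fderiv ℝ (φ l) z (d j l, 0)) ∂slab a b := by
    rw [← integral_finsetSum _ fun j _ => it j]
    simp only [← integral_finsetSum _ fun l _ => ix _ l]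
    rw [← integral_finsetSum _ fun j _ => integrable_finsetSum _ fun l _ => ix j l,
      ← integral_add (integrable_finsetSum _ fun j _ => it j)
        (integrable_finsetSum _ fun j _ => integrable_finsetSum _ fun l _ => ix j l)]
    refine integral_congr_ae (.of_forall fun z => ?_)
    simp only
    rw [← Finset.sum_add_distrib]
    refine Finset.sum_congr rfl fun j _ => ?_
    rw [mul_add, add_mul, Finset.mul_sum, Finset.sum_mul]
    congr 1
    · ring
    · exact Finset.sum_congr rfl fun l _ => by ring
  rw [hsum, hx0, add_zero, Finset.mul_sum]
  exact Finset.sum_congr rfl fun j _ => ht j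

/-- Smooth compactly supported vector fields with support in `{t < b}`. -/
def testFields (ι : Type*) [Fintype ι] (b : ℝ) :
    Submodule ℝ (Space × ℝ → EuclideanSpace ℝ ι) where
  carrier := {φ | ContDiff ℝ ∞ φ ∧ HasCompactSupport φ ∧ tsupport φ ⊆ {z | z.2 < b}}
  add_mem' := fun h₁ h₂ => ⟨h₁.1.add h₂.1, h₁.2.1.add h₂.2.1,
    (tsupport_add _ _).trans (union_subset h₁.2.2 h₂.2.2)⟩
  zero_mem' := ⟨contDiff_const, HasCompactSupport.zero, by simp [tsupport]⟩
  smul_mem' := fun r φ h => ⟨contDiff_const.smul h.1, h.2.1.smul_left (f := fun _ => r),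
    (tsupport_smul_subset_right (fun _ => r) φ).trans h.2.2⟩

/-- The first order differential operator `φ ↦ (c j ∂ₜ (φ j) + ∑ l, ∂_{d j l} (φ l))_j`. -/
noncomputable def systemOp (c : ι → Space → ℝ) (d : ι → ι → Space)
    (φ : Space × ℝ → EuclideanSpace ℝ ι) (z : Space × ℝ) : EuclideanSpace ℝ ι :=
  WithLp.toLp 2 fun j => c j z.1 * fderiv ℝ φ z (0, 1) j + ∑ l, fderiv ℝ φ z (d j l, 0) l

theorem systemOp_add {b : ℝ} (c : ι → Space → ℝ) (d : ι → ι → Space)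
    {φ ψ : Space × ℝ → EuclideanSpace ℝ ι} (hφ : φ ∈ testFields ι b) (hψ : ψ ∈ testFields ι b) :
    systemOp c d (φ + ψ) = systemOp c d φ + systemOp c d ψ := by
  ext z j
  have : fderiv ℝ (φ + ψ) z = fderiv ℝ φ z + fderiv ℝ ψ z :=
    fderiv_add (hφ.1.differentiable (by simp) z) (hψ.1.differentiable (by simp) z)
  simp only [systemOp, this, add_apply, PiLp.add_apply, Pi.add_apply, Finset.sum_add_distrib]
  ring

theorem systemOp_smul {b : ℝ} (c : ι → Space → ℝ) (d : ι → ι → Space) (r : ℝ)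
    {φ : Space × ℝ → EuclideanSpace ℝ ι} (hφ : φ ∈ testFields ι b) :
    systemOp c d (r • φ) = r • systemOp c d φ := by
  ext z j
  have : fderiv ℝ (r • φ) z = r • fderiv ℝ φ z :=
    fderiv_const_smul (hφ.1.differentiable (by simp) z) r
  simp only [systemOp, this, smul_apply, PiLp.smul_apply, Pi.smul_apply,
    smul_eq_mul, ← Finset.mul_sum]
  ring

theorem memLp_coeff_mul {c : Space → ℝ} (hc : Measurable c) {C : ℝ} (hC : ∀ x, |c x| ≤ C)
    {f : Space × ℝ → ℝ} {μ : Measure (Space × ℝ)} (hf : MemLp f 2 μ) :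
    MemLp (fun z => c z.1 * f z) 2 μ :=
  hf.mul (r := 2) (memLp_top_of_bound (hc.comp measurable_fst).aestronglyMeasurable C
    (.of_forall fun z => hC z.1))

theorem memLp_systemOp {b : ℝ} {c : ι → Space → ℝ} (hc : ∀ j, Measurable (c j))
    {C : ℝ} (hC : ∀ j x, |c j x| ≤ C) (d : ι → ι → Space)
    {φ : Space × ℝ → EuclideanSpace ℝ ι} (hφ : φ ∈ testFields ι b)
    (μ : Measure (Space × ℝ)) [IsFiniteMeasureOnCompacts μ] :
    MemLp (systemOp c d φ) 2 μ := by
  have h : ∀ v l, MemLp (fun z => fderiv ℝ φ z v l) 2 μ := fun v l =>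
    ((((hφ.1.continuous_fderiv (by simp)).clm_apply
      continuous_const).memLp_of_hasCompactSupport (hφ.2.1.fderiv_apply (𝕜 := ℝ) v))).eval_piLp l
  refine MemLp.of_eval_piLp fun j => ?_
  exact (memLp_coeff_mul (hc j) (hC j) (h (0, 1) j)).add
    (memLp_finsetSum _ fun l _ => h (d j l, 0) l)

/-- In the energy identity, bound `c` below by `ε` and `t - a` above by `b - a`; Cauchy–Schwarz then
leaves one factor `‖φ‖` to cancel. -/
theorem norm_testField_le {a b : ℝ} (hab : a ≤ b) {c : ι → Space → ℝ} (hc : ∀ j, Measurable (c j))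
    {C : ℝ} (hC : ∀ j x, |c j x| ≤ C) {ε : ℝ} (hε : 0 < ε) (hεc : ∀ j x, ε ≤ c j x)
    {d : ι → ι → Space} (hd : ∀ j l, d j l = d l j)
    {φ : Space × ℝ → EuclideanSpace ℝ ι} (hφ : φ ∈ testFields ι b)
    (m₁ : MemLp φ 2 (slab a b)) (m₂ : MemLp (systemOp c d φ) 2 (slab a b)) :
    ‖m₁.toLp φ‖ ≤ ε⁻¹ * (2 * (b - a)) * ‖m₂.toLp (systemOp c d φ)‖ := by
  have hφd : Differentiable ℝ φ := hφ.1.differentiable (by simp)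
  have hev : ∀ j z v, fderiv ℝ (fun z => φ z j) z v = fderiv ℝ φ z v j := by
    intro j z v
    have h := ((EuclideanSpace.proj j : EuclideanSpace ℝ ι →L[ℝ] ℝ).hasFDerivAt).comp z
      (hφd z).hasFDerivAt
    rw [show fderiv ℝ (fun z => φ z j) z = _ from h.fderiv]
    rfl
  have hcomp : ∀ j, HasCompactSupport fun z => φ z j := fun j =>
    hφ.2.1.comp_left (g := fun v : EuclideanSpace ℝ ι => v j) rfl
  have hφb : ∀ x, φ (x, b) = 0 := fun x => by
    by_contra hne
    exact lt_irrefl b (hφ.2.2 (subset_tsupport φ hne))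
  have hid := energy_identity hab hc hC hd (φ := fun j z => φ z j)
    (fun j => (EuclideanSpace.proj j : EuclideanSpace ℝ ι →L[ℝ] ℝ).contDiff.comp hφ.1)
    hcomp (fun j x => by rw [hφb]; rfl)
  simp only [hev] at hid
  have hae : ∀ᵐ z ∂slab a b, z.2 ∈ Icc a b := by
    filter_upwards [ae_restrict_mem (MeasurableSet.univ.prod measurableSet_Icc)] with z hz
    exact hz.2
  have m₃ : MemLp (fun z => (z.2 - a) • systemOp c d φ z) 2 (slab a b) := by
    refine MemLp.smul (p := ∞) (q := 2) (φ := fun z => z.2 - a) m₂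
      (memLp_top_of_bound (by fun_prop) (b - a) ?_)
    filter_upwards [hae] with z hz
    rw [Real.norm_eq_abs, abs_of_nonneg (by linarith [hz.1])]
    linarith [hz.2]
  have hn : ‖m₃.toLp _‖ ≤ (b - a) * ‖m₂.toLp _‖ := by
    refine Lp.norm_le_mul_norm_of_ae_le_mul ?_
    filter_upwards [hae, m₂.coeFn_toLp, m₃.coeFn_toLp] with z hz h₂ h₃
    rw [h₂, h₃, norm_smul, Real.norm_eq_abs, abs_of_nonneg (by linarith [hz.1])]
    gcongr
    exact hz.2
  have hin : ∫ z, ∑ j, (z.2 - a) * (c j z.1 * fderiv ℝ φ z (0, 1) j +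
      ∑ l, fderiv ℝ φ z (d j l, 0) l) * φ z j ∂slab a b = ⟪m₃.toLp _, m₁.toLp φ⟫_ℝ := by
    rw [L2.inner_def]
    refine integral_congr_ae ?_
    filter_upwards [m₁.coeFn_toLp, m₃.coeFn_toLp] with z h₁ h₃
    rw [h₁, h₃, PiLp.inner_apply]
    refine Finset.sum_congr rfl fun j _ => ?_
    simp [systemOp, mul_comm]
  have hlow : ε * ‖m₁.toLp φ‖ ^ 2 ≤ ∑ j, ∫ z, c j z.1 * φ z j ^ 2 ∂slab a b := by
    rw [← real_inner_self_eq_norm_sq, L2.inner_def, ← integral_const_mul]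
    have hi : ∀ j, Integrable (fun z => φ z j ^ 2) (slab a b) := fun j =>
      (m₁.eval_piLp j).integrable_sq
    have hic : ∀ j, Integrable (fun z => c j z.1 * φ z j ^ 2) (slab a b) := fun j =>
      (hi j).bdd_mul ((hc j).comp measurable_fst).aestronglyMeasurable
        (.of_forall fun z => hC j z.1)
    rw [← integral_finsetSum _ fun j _ => hic j]
    refine integral_mono_ae ((L2.integrable_inner (m₁.toLp φ) (m₁.toLp φ)).const_mul ε)
      (integrable_finsetSum _ fun j _ => hic j) ?_
    filter_upwards [m₁.coeFn_toLp] with z h₁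
    simp only [h₁, PiLp.inner_apply, Finset.mul_sum]
    refine Finset.sum_le_sum fun j _ => ?_
    have : ⟪φ z j, φ z j⟫_ℝ = φ z j ^ 2 := by simp
    rw [this]
    gcongr
    exact hεc j z.1
  rw [hid, hin] at hlow
  have hcs := abs_real_inner_le_norm (m₃.toLp _) (m₁.toLp φ)
  have h1 : ε * ‖m₁.toLp φ‖ ^ 2 ≤ 2 * (b - a) * ‖m₂.toLp _‖ * ‖m₁.toLp φ‖ := by
    have := neg_abs_le ⟪m₃.toLp _, m₁.toLp φ⟫_ℝ
    have := mul_le_mul_of_nonneg_right hn (norm_nonneg (m₁.toLp φ))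
    linarith
  rcases (norm_nonneg (m₁.toLp φ)).eq_or_lt with h0 | h0
  · rw [← h0]
    have : 0 ≤ b - a := by linarith
    positivity
  · rw [mul_assoc, ← div_eq_inv_mul, le_div_iff₀ hε]
    nlinarith

/-- The Cauchy problem for a symmetric hyperbolic first order system with time-independent bounded
measurable coefficients has a square integrable weak solution. -/
theorem exists_isWeakSolution {a b : ℝ} (hab : a ≤ b) {c : ι → Space → ℝ}
    (hc : ∀ j, Measurable (c j)) {C : ℝ} (hC : ∀ j x, |c j x| ≤ C) {ε : ℝ} (hε : 0 < ε)
    (hεc : ∀ j x, ε ≤ c j x) {d : ι → ι → Space} (hd : ∀ j l, d j l = d l j)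
    {q : ι → Space × ℝ → ℝ} (hq : ∀ j, MemLp (q j) 2) (hq0 : ∀ j z, z.2 ∉ Icc a b → q j z = 0) :
    ∃ u : ι → Space × ℝ → ℝ, (∀ j, MemLp (u j) 2) ∧ (∀ j z, z.2 ∉ Icc a b → u j z = 0) ∧
      IsWeakSolution (Iio b) c d u q := by
  classical
  have hV : ∀ φ : testFields ι b, MemLp φ.1 2 (slab a b) := fun φ =>
    φ.2.1.continuous.memLp_of_hasCompactSupport φ.2.2.1
  have hO : ∀ φ : testFields ι b, MemLp (systemOp c d φ.1) 2 (slab a b) := fun φ =>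
    memLp_systemOp hc hC d φ.2 _
  let A : testFields ι b →ₗ[ℝ] Lp (EuclideanSpace ℝ ι) 2 (slab a b) :=
    { toFun := fun φ => (hO φ).toLp _
      map_add' := fun φ ψ => by
        rw [← MemLp.toLp_add]
        exact MemLp.toLp_congr _ _ (.of_eq (systemOp_add c d φ.2 ψ.2))
      map_smul' := fun r φ => by
        rw [RingHom.id_apply, ← MemLp.toLp_const_smul]
        exact MemLp.toLp_congr _ _ (.of_eq (systemOp_smul c d r φ.2)) }
  let B : testFields ι b →ₗ[ℝ] Lp (EuclideanSpace ℝ ι) 2 (slab a b) :=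
    { toFun := fun φ => (hV φ).toLp _
      map_add' := fun φ ψ => MemLp.toLp_add _ _
      map_smul' := fun r φ => MemLp.toLp_const_smul r _ }
  have mq : MemLp (fun z => (WithLp.toLp 2 fun j => q j z : EuclideanSpace ℝ ι)) 2 (slab a b) :=
    MemLp.of_eval_piLp fun j => (hq j).restrict _
  -- The sign of `-mq.toLp _` matches the right side `-∫ q k` of the weak formulation.
  obtain ⟨u, hu⟩ := exists_inner_eq_of_norm_le A B _
    (fun φ => norm_testField_le hab hc hC hε hεc hd φ.2 (hV φ) (hO φ)) (-mq.toLp _)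
  have hs : MeasurableSet ((univ : Set Space) ×ˢ Icc a b) :=
    MeasurableSet.univ.prod measurableSet_Icc
  have mu : ∀ j, MemLp (fun z => u z j) 2 (slab a b) := fun j => (Lp.memLp u).eval_piLp j
  have hind : ∀ (f g : Space × ℝ → ℝ), ∫ z, (univ ×ˢ Icc a b).indicator f z * g z =
      ∫ z, f z * g z ∂slab a b := by
    intro f g
    rw [slab, ← integral_indicator hs]
    refine integral_congr_ae (.of_forall fun z => ?_)
    simp only [indicator]
    split_ifs <;> simp
  refine ⟨fun j => (univ ×ˢ Icc a b).indicator fun z => u z j,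
    fun j => (memLp_indicator_iff_restrict hs).2 (mu j),
    fun j z hz => indicator_of_notMem (fun h => hz h.2) _, fun k hk hkc hks m => ?_⟩
  have hkd : Differentiable ℝ k := hk.differentiable (by simp)
  -- A test field concentrated in component `m` isolates the `m`-th equation.
  let φ : Space × ℝ → EuclideanSpace ℝ ι := fun z => k z • EuclideanSpace.single m (1 : ℝ)
  have hφ : φ ∈ testFields ι b := by
    refine ⟨hk.smul contDiff_const, hkc.smul_right, ?_⟩
    exact (tsupport_smul_subset_left k fun _ => EuclideanSpace.single m (1 : ℝ)).trans hks
  have hfφ : ∀ z v l, fderiv ℝ φ z v l = if l = m then fderiv ℝ k z v else 0 := by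
    intro z v l
    rw [show fderiv ℝ φ z = _ from ((hkd z).hasFDerivAt.smul_const _).fderiv]
    simp
  have hDm : ∀ v, MemLp (fun z => fderiv ℝ k z v) 2 (slab a b) := fun v =>
    ((hk.continuous_fderiv (by simp)).clm_apply
      continuous_const).memLp_of_hasCompactSupport (hkc.fderiv_apply (𝕜 := ℝ) v)
  have hL : ⟪u, A ⟨φ, hφ⟩⟫_ℝ = (∫ z, c m z.1 * u z m * fderiv ℝ k z (0, 1) ∂slab a b) +
      ∑ l, ∫ z, u z l * fderiv ℝ k z (d m l, 0) ∂slab a b := by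
    have hi : ∀ l v, Integrable (fun z => u z l * fderiv ℝ k z v) (slab a b) := fun l v =>
      (mu l).integrable_mul (hDm v)
    have hi' : Integrable (fun z => c m z.1 * u z m * fderiv ℝ k z (0, 1)) (slab a b) :=
      (memLp_coeff_mul (hc m) (hC m) (mu m)).integrable_mul (hDm _)
    rw [L2.inner_def, ← integral_finsetSum _ fun l _ => hi l _,
      ← integral_add hi' (integrable_finsetSum _ fun l _ => hi l _)]
    refine integral_congr_ae ?_
    filter_upwards [(hO ⟨φ, hφ⟩).coeFn_toLp] with z hz
    have hz' : (A ⟨φ, hφ⟩) z = systemOp c d φ z := hz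
    rw [hz', PiLp.inner_apply]
    simp only [systemOp, hfφ, Finset.sum_ite_eq', Finset.mem_univ, if_true]
    simp only [RCLike.inner_apply, conj_trivial, add_mul, Finset.sum_add_distrib, mul_ite,
      ite_mul, mul_zero, zero_mul, Finset.sum_ite_eq', Finset.mem_univ, if_true]
    congr 1
    · ring
    · refine Finset.sum_congr rfl fun l _ => ?_
      rw [hd l m, mul_comm]
  have hR : ⟪-mq.toLp _, B ⟨φ, hφ⟩⟫_ℝ = -∫ z, q m z * k z ∂slab a b := by
    rw [inner_neg_left, L2.inner_def]
    congr 1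
    refine integral_congr_ae ?_
    filter_upwards [(hV ⟨φ, hφ⟩).coeFn_toLp, mq.coeFn_toLp] with z hz hz₂
    have hz' : (B ⟨φ, hφ⟩) z = φ z := hz
    rw [hz', hz₂, PiLp.inner_apply]
    simp [φ, mul_comm]
  have hq' : ∀ z, (univ ×ˢ Icc a b).indicator (q m) z = q m z := by
    intro z
    rw [indicator_apply_eq_self]
    exact fun h => hq0 m z fun h' => h ⟨trivial, h'⟩
  have := hu ⟨φ, hφ⟩
  rw [hL, hR] at this
  have hq'' : ∫ z, q m z * k z = ∫ z, q m z * k z ∂slab a b := by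
    rw [← hind]
    simp only [hq']
  have ht := hind (fun z => u z m) fun z => c m z.1 * fderiv ℝ k z (0, 1)
  simp only [mul_left_comm _ (c m _), ← mul_assoc] at ht
  rw [hq'', ← this, ht]
  simp only [hind]

end System

open Medium

/-! ### Time reversal of systems; maps with a formal adjoint. -/

section System

variable {ι : Type*} [Fintype ι]

/-- The reflection of space-time in time, as a homeomorphism. -/
def reflectHomeomorph (r : ℝ) : Space × ℝ ≃ₜ Space × ℝ :=
  (Homeomorph.refl Space).prodCongr (Homeomorph.subLeft r)

theorem reflect_reflect (r : ℝ) (z : Space × ℝ) : reflect r (reflect r z) = z := by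
  simp [reflect]

theorem measurePreserving_reflect_volume (r : ℝ) :
    MeasurePreserving (reflect r) (volume : Measure (Space × ℝ)) volume :=
  (MeasurePreserving.id _).prod (Measure.measurePreserving_sub_left volume r)

theorem integral_comp_reflect (r : ℝ) (f : Space × ℝ → ℝ) :
    ∫ z, f (reflect r z) = ∫ z, f z :=
  (measurePreserving_reflect_volume r).integral_comp
    (reflectHomeomorph r).measurableEmbedding f

theorem fderiv_comp_reflect {k : Space × ℝ → ℝ} (hk : Differentiable ℝ k) (r : ℝ)
    (z : Space × ℝ) (v : Space) (τ : ℝ) :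
    fderiv ℝ (fun z => k (reflect r z)) z (v, τ) = fderiv ℝ k (reflect r z) (v, -τ) := by
  have h0 : HasFDerivAt (reflect r) ((ContinuousLinearMap.fst ℝ Space ℝ).prod
      (-ContinuousLinearMap.snd ℝ Space ℝ)) z :=
    hasFDerivAt_fst.prodMk (hasFDerivAt_snd.const_sub r)
  have h := (hk (reflect r z)).hasFDerivAt.comp z h0
  rw [show fderiv ℝ (fun z => k (reflect r z)) z = _ from h.fderiv]
  simp

/-- Time reversal of first order systems. -/
theorem IsWeakSolution.comp_reflect {S : Set ℝ} {c : ι → Space → ℝ} {d : ι → ι → Space}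
    {u q : ι → Space × ℝ → ℝ} (h : IsWeakSolution S c d u q) {σ : ι → ℝ}
    (hσ : ∀ j l, d j l = 0 ∨ σ l = -σ j) (r : ℝ) :
    IsWeakSolution {t | r - t ∈ S} c d (fun j z => σ j * u j (reflect r z))
      (fun j z => -(σ j * q j (reflect r z))) := by
  intro k hk hkc hks j
  have hkd : Differentiable ℝ k := hk.differentiable (by simp)
  have hr : ContDiff ℝ ∞ (reflect r) := contDiff_fst.prodMk (contDiff_const.sub contDiff_snd)
  have h1 := h (fun z => k (reflect r z)) (hk.comp hr)
    (hkc.comp_homeomorph (reflectHomeomorph r)) (fun z hz => by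
      have := hks (tsupport_comp_subset_preimage k hr.continuous hz)
      simpa [reflect] using this) j
  simp only [fderiv_comp_reflect hkd, neg_zero] at h1
  have e1 : ∫ z, c j z.1 * (σ j * u j (reflect r z)) * fderiv ℝ k z (0, 1) =
      -σ j * ∫ z, c j z.1 * u j z * fderiv ℝ k (reflect r z) (0, -1) := by
    rw [← integral_comp_reflect r fun z => c j z.1 * u j z * fderiv ℝ k (reflect r z) (0, -1),
      ← integral_const_mul]
    refine integral_congr_ae (.of_forall fun z => ?_)
    have : fderiv ℝ k z (0, -1) = -fderiv ℝ k z (0, 1) := by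
      rw [← map_neg]; simp
    simp only [reflect_reflect, this]
    simp only [reflect]
    ring
  -- Reversal flips the sign of the time derivative. Since coupled components carry opposite signs,
  -- the spatial terms pick up the same factor `-σ j`.
  have e2 : ∀ l, ∫ z, σ l * u l (reflect r z) * fderiv ℝ k z (d j l, 0) =
      -σ j * ∫ z, u l z * fderiv ℝ k (reflect r z) (d j l, 0) := by
    intro l
    rcases hσ j l with h0 | h0
    · have : ∀ z, fderiv ℝ k z ((0 : Space), (0 : ℝ)) = 0 := fun z => map_zero _
      simp [h0, this]
    rw [← integral_comp_reflect r fun z => u l z * fderiv ℝ k (reflect r z) (d j l, 0),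
      ← integral_const_mul]
    refine integral_congr_ae (.of_forall fun z => ?_)
    simp only [reflect_reflect, h0]
    ring
  have e3 : ∫ z, -(σ j * q j (reflect r z)) * k z = -σ j * ∫ z, q j z * k (reflect r z) := by
    rw [← integral_comp_reflect r fun z => q j z * k (reflect r z), ← integral_const_mul]
    refine integral_congr_ae (.of_forall fun z => ?_)
    simp only [reflect_reflect]
    ring
  simp only [e1, e2, e3, ← Finset.mul_sum]
  rw [← mul_add, h1]
  ring

theorem IsWeakSolution.congr {S : Set ℝ} {c : ι → Space → ℝ} {d : ι → ι → Space}
    {u q u' q' : ι → Space × ℝ → ℝ} (h : IsWeakSolution S c d u q)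
    (hu : ∀ j, u j =ᵐ[volume] u' j) (hq : ∀ j, q j =ᵐ[volume] q' j) :
    IsWeakSolution S c d u' q' := by
  intro k hk hkc hks j
  have e1 : ∫ z, q' j z * k z = ∫ z, q j z * k z :=
    integral_congr_ae (by filter_upwards [hq j] with z hz; rw [hz])
  have e2 : ∫ z, c j z.1 * u' j z * fderiv ℝ k z (0, 1) =
      ∫ z, c j z.1 * u j z * fderiv ℝ k z (0, 1) :=
    integral_congr_ae (by filter_upwards [hu j] with z hz; rw [hz])
  have e3 : ∀ l, ∫ z, u' l z * fderiv ℝ k z (d j l, 0) = ∫ z, u l z * fderiv ℝ k z (d j l, 0) :=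
    fun l => integral_congr_ae (by filter_upwards [hu l] with z hz; rw [hz])
  simp only [e1, e2, e3]
  exact h k hk hkc hks j

/-- A function with a formal adjoint between Hilbert spaces is a bounded operator. -/
theorem exists_continuousLinearMap_of_inner_eq {H : Type*} [NormedAddCommGroup H]
    [InnerProductSpace ℝ H] [CompleteSpace H] (F G : H → H)
    (h : ∀ x y, ⟪F x, y⟫_ℝ = ⟪x, G y⟫_ℝ) :
    ∃ F' : H →L[ℝ] H, (∀ x, F' x = F x) ∧ ∀ y, G y = ContinuousLinearMap.adjoint F' y := by
  let L : H →ₗ[ℝ] H :=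
    { toFun := F
      map_add' := fun x y => ext_inner_right ℝ fun z => by
        simp only [inner_add_left, h]
      map_smul' := fun r x => ext_inner_right ℝ fun z => by
        simp only [RingHom.id_apply, real_inner_smul_left, h] }
  -- Hellinger–Toeplitz: the formal adjoint makes the graph closed.
  have hL : Continuous L := by
    refine L.continuous_of_seq_closed_graph fun x x₀ y hx hy => ext_inner_right ℝ fun z => ?_
    have h1 := Filter.Tendsto.inner (𝕜 := ℝ) hy (tendsto_const_nhds (x := z))
    have h2 := Filter.Tendsto.inner (𝕜 := ℝ) hx (tendsto_const_nhds (x := G z))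
    have h3 : ∀ n, ⟪(L ∘ x) n, z⟫_ℝ = ⟪x n, G z⟫_ℝ := fun n => h _ _
    simp only [h3] at h1
    exact (tendsto_nhds_unique h1 h2).trans (h _ _).symm
  refine ⟨⟨L, hL⟩, fun x => rfl, fun y => ext_inner_left ℝ fun x => ?_⟩
  rw [ContinuousLinearMap.adjoint_inner_right]
  exact (h x y).symm

end System

/-! ### Weighted measures, and fields as scalar components. -/

namespace Medium

variable {m : Medium} {a b : ℝ}

theorem measurableSet_cyl (m : Medium) (a b : ℝ) : MeasurableSet (m.Ω ×ˢ Icc a b) :=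
  m.isOpen_Ω.measurableSet.prod measurableSet_Icc

/-- A weight that is measurable, and bounded above and below by positive constants on `Ω`. -/
structure IsWeight (m : Medium) (c : Space → ℝ) : Prop where
  measurable : Measurable c
  lower : ∃ ε, 0 < ε ∧ ∀ x ∈ m.Ω, ε ≤ c x
  upper : ∃ C, ∀ x ∈ m.Ω, c x ≤ C

theorem isWeight_ρ (m : Medium) : m.IsWeight m.ρ :=
  ⟨m.measurable_ρ, m.uniform_pos.imp fun _ h => ⟨h.1, fun x hx => (h.2 x hx).1⟩,
    m.bounded.imp fun _ h x hx => (h x hx).1⟩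

theorem isWeight_κ (m : Medium) : m.IsWeight m.κ :=
  ⟨m.measurable_κ, m.uniform_pos.imp fun _ h => ⟨h.1, fun x hx => (h.2 x hx).2⟩,
    m.bounded.imp fun _ h x hx => (h x hx).2⟩

theorem ae_mem_cyl : ∀ᵐ z ∂(m.cyl a b), z.1 ∈ m.Ω := by
  filter_upwards [ae_restrict_mem (measurableSet_cyl m a b)] with z hz using hz.1

variable {c : Space → ℝ}

theorem IsWeight.pos (hc : m.IsWeight c) {x : Space} (hx : x ∈ m.Ω) : 0 < c x := by
  obtain ⟨ε, hε, h⟩ := hc.lower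
  exact hε.trans_le (h x hx)

theorem IsWeight.exists_cyl_le (hc : m.IsWeight c) (a b : ℝ) :
    ∃ K : ℝ≥0∞, K ≠ ⊤ ∧ m.cyl a b ≤ K • m.wcyl c a b := by
  obtain ⟨ε, hε, h⟩ := hc.lower
  have hε' : ENNReal.ofReal ε ≠ 0 := by simpa using hε
  refine ⟨(ENNReal.ofReal ε)⁻¹, ENNReal.inv_ne_top.2 hε', ?_⟩
  have h1 : ENNReal.ofReal ε • m.cyl a b ≤ m.wcyl c a b := by
    rw [wcyl, ← withDensity_const]
    refine withDensity_mono ?_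
    filter_upwards [ae_mem_cyl] with z hz
    exact ENNReal.ofReal_le_ofReal (h _ hz)
  calc m.cyl a b = (ENNReal.ofReal ε)⁻¹ • ENNReal.ofReal ε • m.cyl a b := by
        rw [smul_smul, ENNReal.inv_mul_cancel hε' ENNReal.ofReal_ne_top, one_smul]
    _ ≤ _ := by gcongr

theorem IsWeight.exists_wcyl_le (hc : m.IsWeight c) (a b : ℝ) :
    ∃ K : ℝ≥0∞, K ≠ ⊤ ∧ m.wcyl c a b ≤ K • m.cyl a b := by
  obtain ⟨C, h⟩ := hc.upper
  refine ⟨ENNReal.ofReal C, ENNReal.ofReal_ne_top, ?_⟩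
  rw [wcyl, ← withDensity_const]
  refine withDensity_mono ?_
  filter_upwards [ae_mem_cyl] with z hz
  exact ENNReal.ofReal_le_ofReal (h _ hz)

/-- Each of the two measures is at most a finite multiple of the other. -/
theorem IsWeight.memLp_iff (hc : m.IsWeight c) {E : Type*} [NormedAddCommGroup E]
    {f : Space × ℝ → E} : MemLp f 2 (m.wcyl c a b) ↔ MemLp f 2 (m.cyl a b) := by
  obtain ⟨K, hK, h⟩ := hc.exists_cyl_le a b
  obtain ⟨K', hK', h'⟩ := hc.exists_wcyl_le a b
  exact ⟨fun hf => hf.of_measure_le_smul hK h, fun hf => hf.of_measure_le_smul hK' h'⟩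

theorem IsWeight.ae_iff (hc : m.IsWeight c) {p : Space × ℝ → Prop} :
    (∀ᵐ z ∂m.wcyl c a b, p z) ↔ ∀ᵐ z ∂m.cyl a b, p z := by
  obtain ⟨K, hK, h⟩ := hc.exists_cyl_le a b
  exact ⟨fun hf => (Measure.absolutelyContinuous_of_le_smul h).ae_le hf,
    fun hf => (withDensity_absolutelyContinuous _ _).ae_le hf⟩

theorem IsWeight.integral_wcyl (hc : m.IsWeight c) (f : Space × ℝ → ℝ) :
    ∫ z, f z ∂m.wcyl c a b = ∫ z in m.Ω ×ˢ Icc a b, c z.1 * f z := by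
  rw [wcyl, integral_withDensity_eq_integral_toReal_smul
    (f := fun z : Space × ℝ => ENNReal.ofReal (c z.1))
    (hc.measurable.comp measurable_fst).ennreal_ofReal (.of_forall fun z => ENNReal.ofReal_lt_top)]
  refine integral_congr_ae ?_
  filter_upwards [ae_mem_cyl] with z hz
  simp [ENNReal.toReal_ofReal (hc.pos hz).le]

/-- The coefficients `(ρ, ρ, ρ, κ)`, extended by `1` to the complement of `Ω`. -/
noncomputable def coef (m : Medium) : Option (Fin 3) → Space → ℝ
  | some _ => fun x => 1 + m.Ω.indicator (fun x => m.ρ x - 1) x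
  | none => fun x => 1 + m.Ω.indicator (fun x => m.κ x - 1) x

/-- The directions of differentiation in the acoustic system. -/
noncomputable def dir : Option (Fin 3) → Option (Fin 3) → Space
  | some i, none => EuclideanSpace.single i 1
  | none, some i => EuclideanSpace.single i 1
  | _, _ => 0

/-- The signs of the components under time reversal. -/
def sgn : Option (Fin 3) → ℝ
  | some _ => -1
  | none => 1

theorem dir_symm : ∀ j l, dir j l = dir l j
  | some _, some _ => rfl
  | some _, none => rfl
  | none, some _ => rfl
  | none, none => rfl

/-- The system couples velocity only to pressure, and reversal negates exactly one of them. -/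
theorem dir_sgn : ∀ j l, dir j l = 0 ∨ sgn l = -sgn j
  | some _, some _ => Or.inl rfl
  | some _, none => Or.inr (by simp [sgn])
  | none, some _ => Or.inr rfl
  | none, none => Or.inl rfl

theorem sgn_mul_self : ∀ j, sgn j * sgn j = 1
  | some _ => by simp [sgn]
  | none => by simp [sgn]

theorem measurable_coef (m : Medium) : ∀ j, Measurable (m.coef j)
  | some _ => ((m.measurable_ρ.sub_const 1).indicator m.isOpen_Ω.measurableSet).const_add 1
  | none => ((m.measurable_κ.sub_const 1).indicator m.isOpen_Ω.measurableSet).const_add 1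

theorem coef_some {x : Space} (hx : x ∈ m.Ω) (i : Fin 3) : m.coef (some i) x = m.ρ x := by
  simp [coef, hx]

theorem coef_none {x : Space} (hx : x ∈ m.Ω) : m.coef none x = m.κ x := by
  simp [coef, hx]

/-- Because of the extension by `1` the bounds hold on all of space, as the whole-space existence
theorem requires. -/
theorem exists_coef_bounds (m : Medium) :
    ∃ ε C : ℝ, 0 < ε ∧ (∀ j x, ε ≤ m.coef j x) ∧ ∀ j x, |m.coef j x| ≤ C := by
  obtain ⟨ε, hε, h⟩ := m.uniform_pos
  obtain ⟨C, hC⟩ := m.bounded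
  have h1 : ∀ j x, min ε 1 ≤ m.coef j x ∧ m.coef j x ≤ max C 1 := by
    intro j x
    by_cases hx : x ∈ m.Ω
    · rcases j with _ | i
      · rw [coef_none hx]
        exact ⟨min_le_of_left_le (h x hx).2, le_max_of_le_left (hC x hx).2⟩
      · rw [coef_some hx]
        exact ⟨min_le_of_left_le (h x hx).1, le_max_of_le_left (hC x hx).1⟩
    · have : m.coef j x = 1 := by
        cases j <;> simp [coef, hx]
      rw [this]
      exact ⟨min_le_right _ _, le_max_right _ _⟩
  have h2 : 0 < min ε 1 := lt_min hε one_pos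
  refine ⟨min ε 1, max C 1, h2, fun j x => (h1 j x).1, fun j x => ?_⟩
  rw [abs_of_pos (h2.trans_le (h1 j x).1)]
  exact (h1 j x).2

/-- The scalar components `(v₁, v₂, v₃, p)` of a field, extended by zero to space-time. -/
noncomputable def comp (u : m.U a b) : Option (Fin 3) → Space × ℝ → ℝ
  | some i => (m.Ω ×ˢ Icc a b).indicator fun z => vel u z i
  | none => (m.Ω ×ˢ Icc a b).indicator (pres u)

theorem memLp_vel (u : m.U a b) : MemLp (vel u) 2 (m.cyl a b) :=
  m.isWeight_ρ.memLp_iff.1 (Lp.memLp u.fst)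

theorem memLp_pres (u : m.U a b) : MemLp (pres u) 2 (m.cyl a b) :=
  m.isWeight_κ.memLp_iff.1 (Lp.memLp u.snd)

theorem memLp_comp (u : m.U a b) : ∀ j, MemLp (comp u j) 2
  | some i => (memLp_indicator_iff_restrict (measurableSet_cyl m a b)).2
      ((memLp_vel u).eval_piLp i)
  | none => (memLp_indicator_iff_restrict (measurableSet_cyl m a b)).2 (memLp_pres u)

theorem comp_eq_zero (u : m.U a b) : ∀ j z, z ∉ m.Ω ×ˢ Icc a b → comp u j z = 0
  | some _, _, hz => by simp [comp, hz]
  | none, _, hz => by simp [comp, hz]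

theorem ae_eq_of_ae_cyl {f g : Space × ℝ → ℝ} (h : ∀ᵐ z ∂m.cyl a b, f z = g z)
    (hf : ∀ z, z ∉ m.Ω ×ˢ Icc a b → f z = 0) (hg : ∀ z, z ∉ m.Ω ×ˢ Icc a b → g z = 0) :
    f =ᵐ[volume] g := by
  filter_upwards [(ae_restrict_iff' (measurableSet_cyl m a b)).1 h] with z hz
  by_cases hz' : z ∈ m.Ω ×ˢ Icc a b
  · exact hz hz'
  · rw [hf z hz', hg z hz']

theorem comp_some {u : m.U a b} {z : Space × ℝ} (hz : z ∈ m.Ω ×ˢ Icc a b) (i : Fin 3) :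
    comp u (some i) z = vel u z i := by
  simp only [comp, indicator_of_mem hz]

theorem comp_none {u : m.U a b} {z : Space × ℝ} (hz : z ∈ m.Ω ×ˢ Icc a b) :
    comp u none z = pres u z := by
  simp only [comp, indicator_of_mem hz]

theorem ae_mem_domain : ∀ᵐ z ∂m.cyl a b, z ∈ m.Ω ×ˢ Icc a b :=
  ae_restrict_mem (measurableSet_cyl m a b)

theorem ext_of_comp_ae_eq {u v : m.U a b} (h : ∀ j, comp u j =ᵐ[volume] comp v j) : u = v := by
  have h' : ∀ᵐ z ∂m.cyl a b, ∀ j, comp u j z = comp v j z :=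
    ae_all_iff.2 fun j => ae_restrict_of_ae (h j)
  refine WithLp.ofLp_injective 2 (Prod.ext (Lp.ext ?_) (Lp.ext ?_))
  · refine m.isWeight_ρ.ae_iff.2 ?_
    filter_upwards [h', ae_mem_domain] with z hz hz'
    refine PiLp.ext fun i => ?_
    have := hz (some i)
    rwa [comp_some hz', comp_some hz'] at this
  · refine m.isWeight_κ.ae_iff.2 ?_
    filter_upwards [h', ae_mem_domain] with z hz hz'
    have := hz none
    rwa [comp_none hz', comp_none hz'] at this

theorem comp_gamma_ae (u : m.U a b) (j : Option (Fin 3)) :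
    comp (gamma u) j =ᵐ[volume] fun z => m.coef j z.1 * comp u j z := by
  refine ae_eq_of_ae_cyl (m := m) (a := a) (b := b) ?_ (comp_eq_zero _ j)
    fun z hz => by rw [comp_eq_zero _ j z hz, mul_zero]
  rcases j with _ | i
  · filter_upwards [ae_mem_domain, m.isWeight_κ.ae_iff.1 (memLp_mul m.measurable_κ
      (fun x hx => (exists_bound.choose_spec x hx).2.1) u.snd).coeFn_toLp] with z hz h
    rw [comp_none hz, comp_none hz, coef_none hz.1]
    exact h
  · filter_upwards [ae_mem_domain, m.isWeight_ρ.ae_iff.1 (memLp_mul m.measurable_ρ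
      (fun x hx => (exists_bound.choose_spec x hx).1) u.fst).coeFn_toLp] with z hz h
    rw [comp_some hz, comp_some hz, coef_some hz.1]
    exact congrArg (fun v : Space => v i) h

theorem comp_gammaInv_ae (u : m.U a b) (j : Option (Fin 3)) :
    comp (gammaInv u) j =ᵐ[volume] fun z => (m.coef j z.1)⁻¹ * comp u j z := by
  refine ae_eq_of_ae_cyl (m := m) (a := a) (b := b) ?_ (comp_eq_zero _ j)
    fun z hz => by rw [comp_eq_zero _ j z hz, mul_zero]
  rcases j with _ | i
  · filter_upwards [ae_mem_domain, m.isWeight_κ.ae_iff.1 (memLp_mul m.measurable_κ.inv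
      (fun x hx => (exists_bound.choose_spec x hx).2.2.2) u.snd).coeFn_toLp] with z hz h
    rw [comp_none hz, comp_none hz, coef_none hz.1]
    exact h
  · filter_upwards [ae_mem_domain, m.isWeight_ρ.ae_iff.1 (memLp_mul m.measurable_ρ.inv
      (fun x hx => (exists_bound.choose_spec x hx).2.2.1) u.fst).coeFn_toLp] with z hz h
    rw [comp_some hz, comp_some hz, coef_some hz.1]
    exact congrArg (fun v : Space => v i) h

theorem comp_reverse_ae {a' b' r : ℝ} (ha : a' = r - b) (hb : b' = r - a) (u : m.U a b)
    (j : Option (Fin 3)) :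
    comp (reverse r ha hb u) j =ᵐ[volume] fun z => sgn j * comp u j (reflect r z) := by
  have hmem : ∀ z : Space × ℝ, reflect r z ∈ m.Ω ×ˢ Icc a b ↔ z ∈ m.Ω ×ˢ Icc a' b' := by
    intro z
    simp only [reflect, mem_prod, mem_Icc, ha, hb]
    constructor <;> rintro ⟨h1, h2, h3⟩ <;> exact ⟨h1, by linarith, by linarith⟩
  refine ae_eq_of_ae_cyl (m := m) (a := a') (b := b') ?_ (comp_eq_zero _ j)
    fun z hz => by rw [comp_eq_zero _ j _ (mt (hmem z).1 hz), mul_zero]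
  rcases j with _ | i
  · filter_upwards [ae_mem_domain, m.isWeight_κ.ae_iff.1 (Lp.coeFn_compMeasurePreserving u.snd
      (measurePreserving_reflect m.measurable_κ ha hb))] with z hz h
    rw [comp_none hz, comp_none ((hmem z).2 hz), sgn, one_mul]
    exact h
  · have hmp := measurePreserving_reflect (m := m) m.measurable_ρ ha hb
    filter_upwards [ae_mem_domain, m.isWeight_ρ.ae_iff.1 (Lp.coeFn_compMeasurePreserving u.fst hmp),
      m.isWeight_ρ.ae_iff.1 (Lp.coeFn_neg (Lp.compMeasurePreserving (reflect r) hmp u.fst))]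
      with z hz h h'
    rw [comp_some hz, comp_some ((hmem z).2 hz), sgn, neg_one_mul]
    have h'' : vel (reverse r ha hb u) z = -vel u (reflect r z) :=
      h'.trans (congrArg Neg.neg h)
    rw [h'']
    rfl

theorem inner_eq_sum (u v : m.U a b) :
    inner ℝ u v = ∑ j, ∫ z, m.coef j z.1 * comp u j z * comp v j z := by
  obtain ⟨ε, C, -, -, hC⟩ := m.exists_coef_bounds
  have hi : ∀ j, Integrable fun z => m.coef j z.1 * comp u j z * comp v j z := fun j =>
    (memLp_coeff_mul (m.measurable_coef j) (hC j) (memLp_comp u j)).integrable_mul (memLp_comp v j)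
  have hset : ∀ j, ∫ z, m.coef j z.1 * comp u j z * comp v j z =
      ∫ z in m.Ω ×ˢ Icc a b, m.coef j z.1 * comp u j z * comp v j z := fun j =>
    (setIntegral_eq_integral_of_forall_compl_eq_zero fun z hz => by
      rw [comp_eq_zero u j z hz, mul_zero, zero_mul]).symm
  rw [WithLp.prod_inner_apply, L2.inner_def, L2.inner_def, m.isWeight_ρ.integral_wcyl,
    m.isWeight_κ.integral_wcyl, Fintype.sum_option, add_comm]
  congr 1
  · rw [hset]
    refine integral_congr_ae ?_
    filter_upwards [ae_mem_domain (m := m) (a := a) (b := b)] with z hz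
    rw [comp_none hz, comp_none hz, coef_none hz.1]
    simp only [RCLike.inner_apply, conj_trivial]
    exact (congrArg (m.κ z.1 * ·) (mul_comm _ _)).trans (mul_assoc _ _ _).symm
  · simp only [hset]
    rw [← integral_finsetSum _ fun i _ => (hi (some i)).restrict]
    refine integral_congr_ae ?_
    filter_upwards [ae_mem_domain (m := m) (a := a) (b := b)] with z hz
    simp only [comp_some hz, coef_some hz.1]
    rw [PiLp.inner_apply, Finset.mul_sum]
    refine Finset.sum_congr rfl fun i _ => ?_
    simp only [RCLike.inner_apply, conj_trivial]
    exact (congrArg (m.ρ z.1 * ·) (mul_comm _ _)).trans (mul_assoc _ _ _).symm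

/-! ### The acoustic system as a symmetric system. -/

/-- The defect of the `j`-th equation of the acoustic system, tested against `k`. -/
noncomputable def residual (u q : m.U a b) (j : Option (Fin 3)) (k : Space × ℝ → ℝ) : ℝ :=
  (∫ z, m.coef j z.1 * comp u j z * fderiv ℝ k z (0, 1)) +
    (∑ l, ∫ z, comp u l z * fderiv ℝ k z (dir j l, 0)) + ∫ z, comp q j z * k z

theorem residual_zero (u q : m.U a b) (j : Option (Fin 3)) : residual u q j (fun _ => 0) = 0 := by
  simp [residual]

theorem setIntegral_cyl_eq {f : Space × ℝ → ℝ} (hf : ∀ z, z ∉ m.Ω ×ˢ Icc a b → f z = 0) :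
    ∫ z in m.Ω ×ˢ Icc a b, f z = ∫ z, f z :=
  setIntegral_eq_integral_of_forall_compl_eq_zero hf

theorem fderiv_apply_comp {η : Space × ℝ → Space} (hη : Differentiable ℝ η) (i : Fin 3)
    (z v : Space × ℝ) : fderiv ℝ (fun z => η z i) z v = fderiv ℝ η z v i := by
  have h := ((EuclideanSpace.proj i : Space →L[ℝ] ℝ).hasFDerivAt).comp z (hη z).hasFDerivAt
  rw [show fderiv ℝ (fun z => η z i) z = _ from h.fderiv]
  rfl

theorem dt_eq {E : Type} [NormedAddCommGroup E] [NormedSpace ℝ E] {f : Space × ℝ → E}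
    (hf : Differentiable ℝ f) (z : Space × ℝ) : dt f z = fderiv ℝ f z (0, 1) :=
  (hasDerivAt_comp_prodMk_right hf z.1 z.2).deriv

theorem div_eq {η : Space × ℝ → Space} (hη : Differentiable ℝ η) (z : Space × ℝ) :
    div η z = ∑ i, fderiv ℝ (fun z => η z i) z (EuclideanSpace.single i 1, 0) := by
  refine Finset.sum_congr rfl fun i _ => ?_
  rw [fderiv_comp_prodMk_left hη, fderiv_apply_comp hη]

theorem grad_apply {χ : Space × ℝ → ℝ} (hχ : Differentiable ℝ χ) (z : Space × ℝ) (i : Fin 3) :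
    grad χ z i = fderiv ℝ χ z (EuclideanSpace.single i 1, 0) := by
  rw [← fderiv_comp_prodMk_left hχ z.1 z.2]
  have h : ⟪grad χ z, EuclideanSpace.single i (1 : ℝ)⟫_ℝ =
      fderiv ℝ (fun x => χ (x, z.2)) z.1 (EuclideanSpace.single i 1) := by
    rw [grad, gradient, InnerProductSpace.toDual_symm_apply]
  rw [← h, EuclideanSpace.inner_single_right]
  simp

theorem memLp_test {k : Space × ℝ → ℝ} (hk : ContDiff ℝ ∞ k) (hkc : HasCompactSupport k) :
    MemLp k 2 :=
  hk.continuous.memLp_of_hasCompactSupport hkc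

theorem memLp_fderiv_test {k : Space × ℝ → ℝ} (hk : ContDiff ℝ ∞ k) (hkc : HasCompactSupport k)
    (v : Space × ℝ) : MemLp (fun z => fderiv ℝ k z v) 2 :=
  ((hk.continuous_fderiv (by simp)).clm_apply continuous_const).memLp_of_hasCompactSupport
    (hkc.fderiv_apply (𝕜 := ℝ) v)

theorem integrable_comp_mul_test {k : Space × ℝ → ℝ}
    (hk : ContDiff ℝ ∞ k) (hkc : HasCompactSupport k)
    (u : m.U a b) (j : Option (Fin 3)) :
    Integrable fun z => comp u j z * k z :=
  (memLp_comp u j).integrable_mul (memLp_test hk hkc)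

theorem integrable_comp_mul_fderiv {k : Space × ℝ → ℝ}
    (hk : ContDiff ℝ ∞ k) (hkc : HasCompactSupport k)
    (u : m.U a b) (j : Option (Fin 3)) (v : Space × ℝ) :
    Integrable fun z => comp u j z * fderiv ℝ k z v :=
  (memLp_comp u j).integrable_mul (memLp_fderiv_test hk hkc v)

theorem integrable_coef_mul_fderiv {k : Space × ℝ → ℝ}
    (hk : ContDiff ℝ ∞ k) (hkc : HasCompactSupport k)
    (u : m.U a b) (j : Option (Fin 3)) (v : Space × ℝ) :
    Integrable fun z => m.coef j z.1 * comp u j z * fderiv ℝ k z v := by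
  obtain ⟨ε, C, -, -, hC⟩ := m.exists_coef_bounds
  exact (memLp_coeff_mul (m.measurable_coef j) (hC j) (memLp_comp u j)).integrable_mul
    (memLp_fderiv_test hk hkc v)

theorem velocity_residual (u q : m.U a b) {η : Space × ℝ → Space} (hη : ContDiff ℝ ∞ η)
    (hηc : HasCompactSupport η) :
    (∫ z in m.Ω ×ˢ Icc a b, m.ρ z.1 * ⟪vel u z, dt η z⟫_ℝ) +
      (∫ z in m.Ω ×ˢ Icc a b, pres u z * div η z) + (∫ z in m.Ω ×ˢ Icc a b, ⟪vel q z, η z⟫_ℝ) =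
      ∑ i, residual u q (some i) fun z => η z i := by
  have hd : Differentiable ℝ η := hη.differentiable (by simp)
  have hs : ∀ i, ContDiff ℝ ∞ fun z => η z i := fun i =>
    (EuclideanSpace.proj i : Space →L[ℝ] ℝ).contDiff.comp hη
  have hc : ∀ i, HasCompactSupport fun z => η z i := fun i =>
    hηc.comp_left (g := fun v : Space => v i) rfl
  have e1 : ∫ z in m.Ω ×ˢ Icc a b, m.ρ z.1 * ⟪vel u z, dt η z⟫_ℝ =
      ∑ i, ∫ z, m.coef (some i) z.1 * comp u (some i) z *
        fderiv ℝ (fun z => η z i) z (0, 1) := by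
    rw [← integral_finsetSum _ fun i _ => integrable_coef_mul_fderiv (hs i) (hc i) u _ _,
      ← setIntegral_cyl_eq (m := m) (a := a) (b := b) fun z hz =>
        Finset.sum_eq_zero fun i _ => by rw [comp_eq_zero u _ z hz, mul_zero, zero_mul]]
    refine setIntegral_congr_fun (measurableSet_cyl m a b) fun z hz => ?_
    simp only [comp_some hz, coef_some hz.1, fderiv_apply_comp hd, dt_eq hd]
    rw [PiLp.inner_apply, Finset.mul_sum]
    refine Finset.sum_congr rfl fun i _ => ?_
    simp only [RCLike.inner_apply, conj_trivial]
    ring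
  have e2 : ∫ z in m.Ω ×ˢ Icc a b, pres u z * div η z =
      ∑ i, ∫ z, comp u none z * fderiv ℝ (fun z => η z i) z (EuclideanSpace.single i 1, 0) := by
    rw [← integral_finsetSum _ fun i _ => integrable_comp_mul_fderiv (hs i) (hc i) u _ _,
      ← setIntegral_cyl_eq (m := m) (a := a) (b := b) fun z hz =>
        Finset.sum_eq_zero fun i _ => by rw [comp_eq_zero u _ z hz, zero_mul]]
    refine setIntegral_congr_fun (measurableSet_cyl m a b) fun z hz => ?_
    simp only [comp_none hz, div_eq hd, Finset.mul_sum]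
  have e3 : ∫ z in m.Ω ×ˢ Icc a b, ⟪vel q z, η z⟫_ℝ = ∑ i, ∫ z, comp q (some i) z * η z i := by
    rw [← integral_finsetSum _ fun i _ => integrable_comp_mul_test (hs i) (hc i) q _,
      ← setIntegral_cyl_eq (m := m) (a := a) (b := b) fun z hz =>
        Finset.sum_eq_zero fun i _ => by rw [comp_eq_zero q _ z hz, zero_mul]]
    refine setIntegral_congr_fun (measurableSet_cyl m a b) fun z hz => ?_
    simp only [comp_some hz]
    rw [PiLp.inner_apply]
    refine Finset.sum_congr rfl fun i _ => ?_
    simp only [RCLike.inner_apply, conj_trivial]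
    ring
  have h0 : ∀ (k : Space × ℝ → ℝ) z, fderiv ℝ k z ((0 : Space), (0 : ℝ)) = 0 :=
    fun k z => map_zero _
  rw [e1, e2, e3, ← Finset.sum_add_distrib, ← Finset.sum_add_distrib]
  refine Finset.sum_congr rfl fun i _ => ?_
  simp [residual, Fintype.sum_option, dir, h0]

theorem pressure_residual (u q : m.U a b) {χ : Space × ℝ → ℝ} (hχ : ContDiff ℝ ∞ χ)
    (hχc : HasCompactSupport χ) :
    (∫ z in m.Ω ×ˢ Icc a b, m.κ z.1 * (pres u z * dt χ z)) +
      (∫ z in m.Ω ×ˢ Icc a b, ⟪vel u z, grad χ z⟫_ℝ) + (∫ z in m.Ω ×ˢ Icc a b, pres q z * χ z) =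
      residual u q none χ := by
  have hd : Differentiable ℝ χ := hχ.differentiable (by simp)
  have e1 : ∫ z in m.Ω ×ˢ Icc a b, m.κ z.1 * (pres u z * dt χ z) =
      ∫ z, m.coef none z.1 * comp u none z * fderiv ℝ χ z (0, 1) := by
    rw [← setIntegral_cyl_eq (m := m) (a := a) (b := b) fun z hz => by
      rw [comp_eq_zero u _ z hz, mul_zero, zero_mul]]
    refine setIntegral_congr_fun (measurableSet_cyl m a b) fun z hz => ?_
    simp only [comp_none hz, coef_none hz.1, dt_eq hd]
    ring
  have e2 : ∫ z in m.Ω ×ˢ Icc a b, ⟪vel u z, grad χ z⟫_ℝ =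
      ∑ i, ∫ z, comp u (some i) z * fderiv ℝ χ z (EuclideanSpace.single i 1, 0) := by
    rw [← integral_finsetSum _ fun i _ => integrable_comp_mul_fderiv hχ hχc u _ _,
      ← setIntegral_cyl_eq (m := m) (a := a) (b := b) fun z hz =>
        Finset.sum_eq_zero fun i _ => by rw [comp_eq_zero u _ z hz, zero_mul]]
    refine setIntegral_congr_fun (measurableSet_cyl m a b) fun z hz => ?_
    simp only [comp_some hz]
    rw [PiLp.inner_apply]
    refine Finset.sum_congr rfl fun i _ => ?_
    simp only [RCLike.inner_apply, conj_trivial, grad_apply hd]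
    ring
  have e3 : ∫ z in m.Ω ×ˢ Icc a b, pres q z * χ z = ∫ z, comp q none z * χ z := by
    rw [← setIntegral_cyl_eq (m := m) (a := a) (b := b) fun z hz => by
      rw [comp_eq_zero q _ z hz, zero_mul]]
    refine setIntegral_congr_fun (measurableSet_cyl m a b) fun z hz => ?_
    simp only [comp_none hz]
  have h0 : ∀ (k : Space × ℝ → ℝ) z, fderiv ℝ k z ((0 : Space), (0 : ℝ)) = 0 :=
    fun k z => map_zero _
  rw [e1, e2, e3]
  simp [residual, Fintype.sum_option, dir, h0]

/-- The acoustic system as a symmetric first order system for the components. -/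
theorem isSolution_iff {q u : m.U a b} :
    IsSolution q u ↔ IsWeakSolution (Iio b) m.coef dir (comp u) (comp q) := by
  have hres : IsWeakSolution (Iio b) m.coef dir (comp u) (comp q) ↔ ∀ k : Space × ℝ → ℝ,
      IsTest b k → ∀ j, residual u q j k = 0 := by
    simp only [IsWeakSolution, residual, ← eq_neg_iff_add_eq_zero]
    exact ⟨fun h k hk => h k hk.smooth hk.compact hk.before,
      fun h k h1 h2 h3 => h k ⟨h1, h2, h3⟩⟩
  rw [hres]
  constructor
  · intro h k hk j
    rcases j with _ | i
    · rw [← pressure_residual u q hk.smooth hk.compact]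
      linarith [h.pressure k hk]
    · let η : Space × ℝ → Space := fun z => k z • EuclideanSpace.single i (1 : ℝ)
      have hη : IsTest b η := ⟨hk.smooth.smul contDiff_const, hk.compact.smul_right,
        (tsupport_smul_subset_left k fun _ => EuclideanSpace.single i (1 : ℝ)).trans hk.before⟩
      have h1 := velocity_residual u q hη.smooth hη.compact
      rw [Finset.sum_eq_single i] at h1
      · have : (fun z => η z i) = k := by
          ext z
          simp [η]
        rw [this] at h1
        rw [← h1]
        linarith [h.velocity η hη]
      · intro l _ hl
        have : (fun z => η z l) = fun _ => 0 := by
          ext z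
          simp [η, hl]
        rw [this, residual_zero]
      · simp
  · intro h
    refine ⟨fun η hη => ?_, fun χ hχ => ?_⟩
    · have h1 := velocity_residual u q hη.smooth hη.compact
      rw [Finset.sum_eq_zero fun i _ => h _ ?_ _] at h1
      · linarith
      · refine ⟨(EuclideanSpace.proj i : Space →L[ℝ] ℝ).contDiff.comp hη.smooth,
          hη.compact.comp_left (g := fun v : Space => v i) rfl, ?_⟩
        exact (closure_mono (Function.support_comp_subset (g := fun v : Space => v i) rfl η)).trans
          hη.before
    · have h1 := pressure_residual u q hχ.smooth hχ.compact
      rw [h χ hχ] at h1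
      linarith

/-! ### Fields from components; time reversal of acoustic solutions. -/

/-- Square integrable components supported in the cylinder define a field. -/
theorem exists_comp_ae_eq (m : Medium) {f : Option (Fin 3) → Space × ℝ → ℝ}
    (hf : ∀ j, MemLp (f j) 2) (hf0 : ∀ j z, z ∉ m.Ω ×ˢ Icc a b → f j z = 0) :
    ∃ u : m.U a b, ∀ j, comp u j =ᵐ[volume] f j := by
  have mv : MemLp (fun z => (WithLp.toLp 2 fun i => f (some i) z : Space)) 2 (m.wcyl m.ρ a b) :=
    m.isWeight_ρ.memLp_iff.2 (MemLp.of_eval_piLp fun i => (hf (some i)).restrict _)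
  have mp : MemLp (f none) 2 (m.wcyl m.κ a b) := m.isWeight_κ.memLp_iff.2 ((hf none).restrict _)
  refine ⟨WithLp.toLp 2 (mv.toLp _, mp.toLp _), fun j => ?_⟩
  refine ae_eq_of_ae_cyl (m := m) (a := a) (b := b) ?_ (comp_eq_zero _ j) (hf0 j)
  rcases j with _ | i
  · filter_upwards [ae_mem_domain, m.isWeight_κ.ae_iff.1 mp.coeFn_toLp] with z hz h
    rw [comp_none hz]
    exact h
  · filter_upwards [ae_mem_domain, m.isWeight_ρ.ae_iff.1 mv.coeFn_toLp] with z hz h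
    rw [comp_some hz]
    exact congrArg (fun v : Space => v i) h

/-- The result is a backward solution: test functions now avoid the initial instead of the final
time, and the source changes sign. It is the form that duality consumes. -/
theorem IsSolution.reverse {a' b' r : ℝ} (ha : a' = r - b) (hb : b' = r - a) {q u : m.U a b}
    (h : IsSolution q u) : IsWeakSolution (Ioi a') m.coef dir (comp (reverse r ha hb u))
      (fun j z => -comp (reverse r ha hb q) j z) := by
  have h1 := (isSolution_iff.1 h).comp_reflect dir_sgn r
  have hS : {t | r - t ∈ Iio b} = Ioi a' := by
    ext t
    simp only [mem_ofPred_eq, mem_Iio, mem_Ioi, ha]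
    constructor <;> intro h <;> linarith
  rw [hS] at h1
  refine h1.congr (fun j => (comp_reverse_ae ha hb u j).symm) fun j => ?_
  filter_upwards [comp_reverse_ae ha hb q j] with z hz
  rw [hz]

/-- Translation in time of a solution, as a composition of two time reversals. -/
theorem IsSolution.reverse_reverse {a' b' a'' b'' r s : ℝ} (ha : a' = r - b) (hb : b' = r - a)
    (ha' : a'' = s - b') (hb' : b'' = s - a') {q u : m.U a b} (h : IsSolution q u) :
    IsSolution (Medium.reverse s ha' hb' (Medium.reverse r ha hb q))
      (Medium.reverse s ha' hb' (Medium.reverse r ha hb u)) := by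
  refine isSolution_iff.2 ?_
  have h1 := (IsSolution.reverse ha hb h).comp_reflect dir_sgn s
  have hS : {t | s - t ∈ Ioi a'} = Iio b'' := by
    ext t
    simp only [mem_ofPred_eq, mem_Iio, mem_Ioi, hb']
    constructor <;> intro h <;> linarith
  rw [hS] at h1
  refine h1.congr (fun j => (comp_reverse_ae ha' hb' _ j).symm) fun j => ?_
  filter_upwards [comp_reverse_ae ha' hb' (Medium.reverse r ha hb q) j] with z hz
  rw [hz]
  ring

theorem reverse_reverse_cancel {a' b' r : ℝ} (ha : a' = r - b) (hb : b' = r - a)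
    (ha' : a = r - b') (hb' : b = r - a') (u : m.U a b) :
    Medium.reverse r ha' hb' (Medium.reverse r ha hb u) = u := by
  refine ext_of_comp_ae_eq fun j => ?_
  filter_upwards [comp_reverse_ae ha' hb' (Medium.reverse r ha hb u) j,
    (measurePreserving_reflect_volume r).quasiMeasurePreserving.ae
      (comp_reverse_ae ha hb u j)] with z h1 h2
  rw [h1, h2, ← mul_assoc, sgn_mul_self, one_mul, reflect_reflect]

/-! ### Uniqueness, reciprocity and the solution operator. -/

theorem memLp_coef_comp (u : m.U a b) (j : Option (Fin 3)) :
    MemLp (fun z => m.coef j z.1 * comp u j z) 2 := by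
  obtain ⟨ε, C, -, -, hC⟩ := m.exists_coef_bounds
  exact memLp_coeff_mul (m.measurable_coef j) (hC j) (memLp_comp u j)

/-- A source has at most one solution. -/
theorem IsSolution.unique (hab : a ≤ b) {q u₁ u₂ : m.U a b} (h₁ : IsSolution q u₁)
    (h₂ : IsSolution q u₂) : u₁ = u₂ := by
  obtain ⟨ε, C, hε, hεc, hC⟩ := m.exists_coef_bounds
  let g : Option (Fin 3) → Space × ℝ → ℝ := fun j z => comp u₁ j z - comp u₂ j z
  have mg : ∀ j, MemLp (g j) 2 := fun j => (memLp_comp u₁ j).sub (memLp_comp u₂ j)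
  have hg0 : ∀ j (z : Space × ℝ), z.2 ∉ Icc a b → g j z = 0 := fun j z hz => by
    simp only [g]
    rw [comp_eq_zero u₁ j z fun h => hz h.2, comp_eq_zero u₂ j z fun h => hz h.2, sub_zero]
  have hrefl : ∀ z : Space × ℝ, z.2 ∉ Icc a b → (reflect (a + b) z).2 ∉ Icc a b := by
    intro z hz h
    simp only [reflect, mem_Icc] at h hz
    exact hz ⟨by linarith, by linarith⟩
  have mrefl : ∀ {f : Space × ℝ → ℝ} (σ : ℝ), MemLp f 2 →
      MemLp (fun z => σ * f (reflect (a + b) z)) 2 := fun σ hf =>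
    (hf.comp_measurePreserving (measurePreserving_reflect_volume (a + b))).const_mul σ
  -- The source is chosen so that reflecting `w` in the midpoint of `[a, b]` gives a backward
  -- solution with source `g`. It lives on whole space and may be nonzero outside `Ω`, which is
  -- harmless since `u₁`, `u₂` and `q` vanish there.
  obtain ⟨w, mw, hw0, hw⟩ := exists_isWeakSolution hab m.measurable_coef hC hε hεc dir_symm
    (q := fun j z => -sgn j * g j (reflect (a + b) z)) (fun j => mrefl _ (mg j))
    (fun j z hz => by simp only [hg0 j _ (hrefl z hz), mul_zero])
  have hw' := hw.comp_reflect dir_sgn (a + b)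
  have hS : {t | a + b - t ∈ Iio b} = Ioi a := by
    ext t
    simp only [mem_ofPred_eq, mem_Iio, mem_Ioi]
    constructor <;> intro h <;> linarith
  have hg : (fun j z => -(sgn j * (-sgn j * g j (reflect (a + b) (reflect (a + b) z))))) = g := by
    ext j z
    rw [reflect_reflect]
    linear_combination g j z * sgn_mul_self j
  rw [hS, hg] at hw'
  have dual : ∀ u : m.U a b, IsSolution q u → ∑ j, ∫ z, comp u j z * g j z =
      -∑ j, ∫ z, comp q j z * (sgn j * w j (reflect (a + b) z)) := by
    intro u hu
    refine (isSolution_iff.1 hu).duality dir_symm hw'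
      (fun j z hz => comp_eq_zero u j z fun h => hz.not_ge h.2.1)
      (fun j z hz => ?_) (memLp_comp u) (memLp_comp q) (fun j => mrefl _ (mw j)) mg
      (memLp_coef_comp u) fun j => memLp_coeff_mul (m.measurable_coef j) (hC j) (mrefl _ (mw j))
    simp only [hw0 j _ (hrefl z fun h => hz.not_ge h.2), mul_zero]
  -- The right side of `dual` depends on `q` alone, so pairing `u₁` and `u₂` with their difference
  -- gives the same number.
  have hsum : ∑ j, ∫ z, g j z ^ 2 = 0 := by
    rw [← sub_eq_zero.2 ((dual u₁ h₁).trans (dual u₂ h₂).symm), ← Finset.sum_sub_distrib]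
    refine Finset.sum_congr rfl fun j _ => ?_
    refine Eq.trans ?_ (integral_sub ((memLp_comp u₁ j).integrable_mul (mg j))
      ((memLp_comp u₂ j).integrable_mul (mg j)))
    refine integral_congr_ae (.of_forall fun z => ?_)
    simp only [g]
    ring
  rw [Finset.sum_eq_zero_iff_of_nonneg fun j _ => integral_nonneg fun z => sq_nonneg _] at hsum
  refine ext_of_comp_ae_eq fun j => ?_
  have := (integral_eq_zero_iff_of_nonneg (fun z => sq_nonneg _) (mg j).integrable_sq).1
    (hsum j (Finset.mem_univ j))
  filter_upwards [this] with z hz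
  exact sub_eq_zero.1 (pow_eq_zero_iff two_ne_zero |>.1 hz)

/-- The reciprocity relation `⟪F q, v⟫ = ⟪q, Γ⁻¹ S F S Γ v⟫`. -/
theorem IsSolution.inner_eq {a' b' r : ℝ} (ha : a' = r - b) (hb : b' = r - a) (ha' : a = r - b')
    (hb' : b = r - a') {q u v : m.U a b} {w : m.U a' b'} (hu : IsSolution q u)
    (hw : IsSolution (Medium.reverse r ha hb (gamma v)) w) :
    inner ℝ u v = inner ℝ q (gammaInv (Medium.reverse r ha' hb' w)) := by
  have hw' := IsSolution.reverse ha' hb' hw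
  -- The reversed `w` now has source `-Γ v`; duality then pairs `u` with `Γ v` and `q` with the
  -- reversed `w`.
  rw [reverse_reverse_cancel] at hw'
  have h := (isSolution_iff.1 hu).duality dir_symm hw'
    (fun j z hz => comp_eq_zero u j z fun h => hz.not_ge h.2.1)
    (fun j z hz => comp_eq_zero _ j z fun h => hz.not_ge h.2.2) (memLp_comp u) (memLp_comp q)
    (memLp_comp _) (fun j => (memLp_comp _ j).neg) (memLp_coef_comp u) (memLp_coef_comp _)
  simp only [mul_neg, integral_neg, Finset.sum_neg_distrib, neg_inj] at h
  obtain ⟨ε, C, hε, hεc, hC⟩ := m.exists_coef_bounds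
  rw [inner_eq_sum, inner_eq_sum]
  refine Eq.trans (Finset.sum_congr rfl fun j _ => integral_congr_ae ?_)
    (h.trans (Finset.sum_congr rfl fun j _ => integral_congr_ae ?_))
  · filter_upwards [comp_gamma_ae v j] with z hz
    rw [hz]
    ring
  · filter_upwards [comp_gammaInv_ae (Medium.reverse r ha' hb' w) j] with z hz
    have : m.coef j z.1 ≠ 0 := (hε.trans_le (hεc j z.1)).ne'
    rw [hz]
    field_simp

/-- For `Ω = ℝ³` the whole-space solution is already supported in the cylinder; for smaller `Ω` it
could leak out. -/
theorem exists_isSolution_of_univ (hab : a ≤ b) (hΩ : m.Ω = univ) (q : m.U a b) :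
    ∃ u : m.U a b, IsSolution q u := by
  obtain ⟨ε, C, hε, hεc, hC⟩ := m.exists_coef_bounds
  obtain ⟨f, mf, hf0, hf⟩ := exists_isWeakSolution hab m.measurable_coef hC hε hεc dir_symm
    (memLp_comp q) (fun j z hz => comp_eq_zero q j z fun h => hz h.2)
  obtain ⟨u, hu⟩ := m.exists_comp_ae_eq mf (a := a) (b := b)
    (fun j z hz => hf0 j z fun h => hz ⟨hΩ ▸ mem_univ _, h⟩)
  exact ⟨u, isSolution_iff.2 (hf.congr (fun j => (hu j).symm) fun j => .rfl)⟩

/-- If every source has a solution on an interval and on the reflected interval, then the solution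
operator is bounded and its adjoint is the conjugate of the reflected solution operator. -/
theorem exists_solution_operator (hab : a ≤ b) {a' b' r : ℝ} (ha : a' = r - b) (hb : b' = r - a)
    (ha' : a = r - b') (hb' : b = r - a') (hF : ∀ q : m.U a b, ∃ u, IsSolution q u)
    {F' : m.U a' b' → m.U a' b'} (hF' : ∀ q, IsSolution q (F' q)) :
    ∃ F : m.U a b →L[ℝ] m.U a b, (∀ q u, IsSolution q u ↔ u = F q) ∧
      ∀ v, gammaInv (Medium.reverse r ha' hb' (F' (Medium.reverse r ha hb (gamma v)))) =
        ContinuousLinearMap.adjoint F v := by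
  choose f hf using hF
  obtain ⟨F, h1, h2⟩ := exists_continuousLinearMap_of_inner_eq f
    (fun v => gammaInv (Medium.reverse r ha' hb' (F' (Medium.reverse r ha hb (gamma v)))))
    fun q v => IsSolution.inner_eq ha hb ha' hb' (hf q) (hF' _)
  refine ⟨F, fun q u => ⟨fun h => ?_, fun h => ?_⟩, h2⟩
  · rw [h1]
    exact h.unique hab (hf q)
  · rw [h, h1]
    exact hf q

end Medium

end Acoustic

/-- Write `u = F q` when `u` solves the acoustic system with source `q` and zero initial and
boundary values (on `[0, T]` or on `[T, 2T]`), and `S` for the acoustic time reversal.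
(1) `F q` is unique on both time intervals. (2) `⟪F q, v⟫ = ⟪q, Γ⁻¹ S F S Γ v⟫` in the energy inner
product, whenever `F q` and `F S Γ v` exist. (3) If `F` is defined on all of `U`, then it is a
bounded operator on both time intervals and `Γ⁻¹ S F S Γ v = F* v` for all `v`, with the Hilbert
space adjoint. (4) For `Ω = ℝ³`, `F` is defined on all of `U`. -/
theorem theorem10p2 (m : Medium) (T : ℝ) (hT : 0 < T) :
    ((∀ q u₁ u₂ : m.U 0 T, IsSolution q u₁ → IsSolution q u₂ → u₁ = u₂) ∧
      (∀ q u₁ u₂ : m.U T (2 * T), IsSolution q u₁ → IsSolution q u₂ → u₁ = u₂)) ∧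
    (∀ (q u v : m.U 0 T) (w : m.U T (2 * T)),
      IsSolution q u → IsSolution (revFwd T (gamma v)) w →
        inner ℝ u v = inner ℝ q (gammaInv (revBwd T w))) ∧
    ((∀ q : m.U 0 T, ∃ u : m.U 0 T, IsSolution q u) →
      ∃ (F : m.U 0 T →L[ℝ] m.U 0 T) (F' : m.U T (2 * T) →L[ℝ] m.U T (2 * T)),
        (∀ q u : m.U 0 T, IsSolution q u ↔ u = F q) ∧
        (∀ q u : m.U T (2 * T), IsSolution q u ↔ u = F' q) ∧
        ∀ v : m.U 0 T,
          gammaInv (revBwd T (F' (revFwd T (gamma v)))) = ContinuousLinearMap.adjoint F v) ∧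
    (m.Ω = Set.univ → ∀ q : m.U 0 T, ∃ u : m.U 0 T, IsSolution q u) := by
  have hT2 : T ≤ 2 * T := by linarith
  refine ⟨⟨fun q u₁ u₂ h₁ h₂ => h₁.unique hT.le h₂, fun q u₁ u₂ h₁ h₂ => h₁.unique hT2 h₂⟩,
    fun q u v w hu hw => hu.inner_eq _ _ _ _ hw, fun hF => ?_,
    fun hΩ q => Medium.exists_isSolution_of_univ hT.le hΩ q⟩
  have hshift : ∀ q : m.U T (2 * T), ∃ u, IsSolution q u := by
    intro q
    -- Reflecting by `t ↦ 2T - t` and then by `t ↦ T - t` shifts `[T, 2T]` to `[0, T]`; the solution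
    -- found there is carried back by the same two reflections.
    let q₀ : m.U 0 T := Medium.reverse (2 * T) (by ring) (by ring) q
    obtain ⟨u, hu⟩ := hF (Medium.reverse T (by ring) (by ring) q₀)
    have h := hu.reverse_reverse (a' := 0) (b' := T) (a'' := T) (b'' := 2 * T) (r := T)
      (s := 2 * T) (by ring) (by ring) (by ring) (by ring)
    rw [Medium.reverse_reverse_cancel, Medium.reverse_reverse_cancel] at h
    exact ⟨_, h⟩
  choose f hf using hF
  -- The operator on the later interval is built first, from a bare choice `f` of solutions on `[0,
  -- T]`, so that the adjoint formula for `F` can be stated with the bounded `F'`.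
  obtain ⟨F', hF', -⟩ := Medium.exists_solution_operator (a' := 0) (b' := T) (r := 2 * T) hT2
    (by ring) (by ring) (by ring) (by ring) hshift hf
  obtain ⟨F, hF, hadj⟩ := Medium.exists_solution_operator (a' := T) (b' := 2 * T) (r := 2 * T) hT.le
    (by ring) (by ring) (by ring) (by ring) (fun q => ⟨f q, hf q⟩) (F' := F')
    fun q => (hF' q _).2 rfl
  exact ⟨F, F', hF, hF', hadj⟩
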